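/- Work over $\mathbb{Q}$. Let $\mathrm{CatLie}$ be the $\mathbb{Q}$-linear category (PROP) associated to the Lie operad: its objects are the natural numbers and $\mathrm{CatLie}(m,n)=\bigoplus_{f\colon \{1,\dots,m\}\twoheadrightarrow\{1,\dots,n\}}\bigotimes_{i=1}^n \mathrm{Lie}(|f^{-1}(i)|)$, where $f$ runs over surjections. Equivalently, $\mathrm{CatLie}(m,n)$ is the part of $L_m^{\otimes n}$ that is linear in each generator, where $L_m$ is the free Lie algebra on $x_1,\dots,x_m$; composition is substitution. Left (respectively right) $\mathrm{CatLie}$-modules are covariant (respectively contravariant) $\mathbb{Q}$-linear functors from $\mathrm{CatLie}$ to $\mathbb{Q}$-vector spaces, a bimodule is a bifunctor $B(m,n)$, contravariant in $m$ and covariant in $n$, and for a bimodule $B$ and a left module $M$, $B\otimes_{\mathrm{CatLie}}M$ is the left module $n\mapsto \bigoplus_m B(m,n)\otimes M(m)\big/\big(b\varphi\otimes x-b\otimes\varphi x\big)$. Let $\mathrm{CE}_{\mathrm{Lie}}$ be the universal Chevalley–Eilenberg complex. It is the complex of bimodules with $\mathrm{CE}_t=\mathrm{CatLie}\odot\Lambda^t\mathrm{Lie}$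 for $t\ge 0$, where $\odot$ is the Day convolution product in the contravariant variable; thus $\mathrm{CE}_t(m,n)$ is the part of $L_m^{\otimes n}\otimes\Lambda^t(L_m)$ that is linear in each of $x_1,\dots,x_m$. Its differential is the Chevalley–Eilenberg differential of $L_m$ with coefficients in the right $L_m$-module $L_m^{\otimes n}$, on which $x$ acts by the derivation $y\mapsto[y,x]$; thus $z\otimes x\mapsto z\cdot x$ on $\mathrm{CE}_1$ and $z\otimes (x\wedge y)\mapsto (z\cdot x)\otimes y-(z\cdot y)\otimes x-z\otimes[x,y]$ on $\mathrm{CE}_2$. Let $\delta^{(1)}\mathrm{CatLie}\subset \mathrm{CE}_1$ be spanned by the elements $z\otimes x_a$ with $x_a$ a generator, and let $\pi\colon\mathrm{CE}_1\to\delta^{(1)}\mathrm{CatLie}$ be the projection given by $\pi(z\otimes w)=\sum_k (z\cdot u_k)\otimes x_{a_k}$ if $w\in L_m$ equals $\sum_k u_k x_{a_k}$ in the free associative algebra on $x_1,\dots,x_m$, with $z\cdot u_k$ given by the extension of the action to that algebra. Give $\delta^{(1)}\mathrm{CatLie}$ the unique bimodule structure for which $\pi$ is a morphism of bimodules. Let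 $\mathbb{C}\mathrm{Lie}$ be the complex of bimodules with $\mathrm{CatLie}$ in degree $0$, $\delta^{(1)}\mathrm{CatLie}$ in degree $1$ and $0$ in all other degrees, with differential the restriction of $\mathrm{CE}_1\to\mathrm{CE}_0$. There is a surjection of complexes of bimodules $\mathrm{CE}_{\mathrm{Lie}}\twoheadrightarrow\mathbb{C}\mathrm{Lie}$ given by the identity of $\mathrm{CatLie}$ in degree $0$, by $\pi$ in degree $1$, and by $0$ in higher degrees. **Corollary.** For $M$ a left $\mathrm{CatLie}$-module, this surjection induces a morphism of complexes of left $\mathrm{CatLie}$-modules $$\mathrm{CE}_{\mathrm{Lie}}\otimes_{\mathrm{CatLie}}M\twoheadrightarrow\mathbb{C}\mathrm{Lie}\otimes_{\mathrm{CatLie}}M$$ that is natural in $M$ and surjective (in every degree). The induced natural transformation of graded left $\mathrm{CatLie}$-modules $$H_*(\mathrm{CE}_{\mathrm{Lie}}\otimes_{\mathrm{CatLie}}M)\twoheadrightarrow H_*(\mathbb{C}\mathrm{Lie}\otimes_{\mathrm{CatLie}}M)$$ is surjective, in particular in degree $1$ (in degrees at least $2$ the target is zero), and it is an isomorphism in degree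 $0$. -/

import Mathlib

open CategoryTheory TensorProduct

universe u

noncomputable section

namespace LieProp

/-- The tensor power `V^{⊗ n}` over `ℚ`. -/
abbrev Tens (n : ℕ) (V : Type*) [AddCommGroup V] [Module ℚ V] : Type _ := ⨂[ℚ] _ : Fin n, V

/-- The multiset of letters of a nonassociative word (a binary tree with labelled leaves). -/
def leaves {α : Type*} : FreeMagma α → Multiset α
  | .of a => {a}
  | .mul s t => leaves s + leaves t

/-- The iterated bracket in `g` described by a nonassociative word, with letters evaluated by `X`. -/
def lieWord {α g : Type*} [LieRing g] (X : α → g) : FreeMagma α → g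
  | .of a => X a
  | .mul s t => ⁅lieWord X s, lieWord X t⁆

section Words

variable {α β g h : Type*} [LieRing g] [LieRing h]

@[simp] theorem leaves_of (a : α) : leaves (FreeMagma.of a) = {a} := rfl
@[simp] theorem leaves_mul (s t : FreeMagma α) : leaves (s * t) = leaves s + leaves t := rfl
@[simp] theorem lieWord_of (X : α → g) (a : α) : lieWord X (FreeMagma.of a) = X a := rfl
@[simp] theorem lieWord_mul (X : α → g) (s t : FreeMagma α) :
    lieWord X (s * t) = ⁅lieWord X s, lieWord X t⁆ := rfl

theorem leaves_lift (S : α → FreeMagma β) (T : FreeMagma α) :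
    leaves (FreeMagma.lift S T) = (leaves T).bind fun a => leaves (S a) := by
  induction T with
  | ih1 a => simp
  | ih2 s t hs ht => simp [hs, ht]

theorem lieWord_lift (S : α → FreeMagma β) (X : β → g) (T : FreeMagma α) :
    lieWord X (FreeMagma.lift S T) = lieWord (fun a => lieWord X (S a)) T := by
  induction T with
  | ih1 a => simp
  | ih2 s t hs ht => simp [hs, ht]

variable [LieAlgebra ℚ g] [LieAlgebra ℚ h]

theorem map_lieWord (f : g →ₗ⁅ℚ⁆ h) (X : α → g) (T : FreeMagma α) :
    f (lieWord X T) = lieWord (fun a => f (X a)) T := by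
  induction T with
  | ih1 a => simp
  | ih2 s t hs ht => simp [hs, ht]

theorem lift_lieWord (X : α → g) (T : FreeMagma α) :
    FreeLieAlgebra.lift ℚ X (lieWord (FreeLieAlgebra.of ℚ) T) = lieWord X T := by
  simp [map_lieWord]

variable [DecidableEq α]

theorem lieWord_update_of_notMem {α g : Type*} [LieRing g] [DecidableEq α] (X : α → g) (a : α) (v : g) (T : FreeMagma α)
    (h : a ∉ leaves T) : lieWord (Function.update X a v) T = lieWord X T := by
  induction T with
  | ih1 b =>
    simp only [leaves_of, Multiset.mem_singleton] at h
    simp [Function.update_of_ne (Ne.symm h)]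
  | ih2 s t hs ht =>
    simp only [leaves_mul, Multiset.mem_add, not_or] at h
    simp [hs h.1, ht h.2]

theorem lieWord_update_linear (X : α → g) (a : α) (T : FreeMagma α)
    (h : (leaves T).count a = 1) :
    ∃ l : g →ₗ[ℚ] g, ∀ v, lieWord (Function.update X a v) T = l v := by
  induction T with
  | ih1 b =>
    simp only [leaves_of, Multiset.count_singleton] at h
    obtain rfl : a = b := by by_contra hne; simp [hne] at h
    exact ⟨LinearMap.id, fun v => by simp⟩
  | ih2 s t hs ht =>
    simp only [leaves_mul, Multiset.count_add] at h
    rcases Nat.eq_zero_or_pos ((leaves s).count a) with h0 | h0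
    · obtain ⟨l, hl⟩ := ht (by omega)
      refine ⟨(LieAlgebra.ad ℚ g (lieWord X s) : Module.End ℚ g) ∘ₗ l, fun v => ?_⟩
      simp [hl, lieWord_update_of_notMem X a v s (Multiset.count_eq_zero.1 h0)]
    · obtain ⟨l, hl⟩ := hs (by omega)
      refine ⟨-((LieAlgebra.ad ℚ g (lieWord X t) : Module.End ℚ g) ∘ₗ l), fun v => ?_⟩
      rw [lieWord_mul, hl,
        lieWord_update_of_notMem X a v t (Multiset.count_eq_zero.1 (by omega))]
      simp

end Words

/-- A function of a family `X : α → g` that is linear in each `X a` separately. -/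
def IsMultilin {α g N : Type*} [DecidableEq α] [AddCommGroup g] [Module ℚ g] [AddCommGroup N]
    [Module ℚ N] (F : (α → g) → N) : Prop :=
  ∀ X a, ∃ l : g →ₗ[ℚ] N, ∀ v, F (Function.update X a v) = l v

section Polarize

variable {α g N N₀ N₁ : Type*} [hα : DecidableEq α] [AddCommGroup g] [Module ℚ g] [AddCommGroup N]
  [Module ℚ N] [AddCommGroup N₀] [Module ℚ N₀] [AddCommGroup N₁] [Module ℚ N₁]

theorem isMultilin_span (E : (α → g) → N₀ →ₗ[ℚ] N₁) (s : Set N₀)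
    (h : ∀ z ∈ s, IsMultilin fun X => E X z) :
    ∀ z ∈ Submodule.span ℚ s, IsMultilin fun X => E X z := by
  intro z hz
  induction hz using Submodule.span_induction with
  | mem z hz => exact h z hz
  | zero => exact fun X a => ⟨0, fun v => by simp⟩
  | add y z _ _ hy hz =>
    intro X a
    obtain ⟨l, hl⟩ := hy X a
    obtain ⟨l', hl'⟩ := hz X a
    exact ⟨l + l', fun v => by simp [← hl, ← hl']⟩
  | smul c z _ hz =>
    intro X a
    obtain ⟨l, hl⟩ := hz X a
    exact ⟨c • l, fun v => by simp [← hl]⟩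

theorem IsMultilin.comp_linear {F : (α → g) → N} (h : IsMultilin F) (f : N →ₗ[ℚ] N₁) :
    IsMultilin fun X => f (F X) := fun X a => by
  obtain ⟨l, hl⟩ := h X a
  exact ⟨f ∘ₗ l, fun v => by simp [hl]⟩

/-- If `X ↦ E X z` is multilinear for every `z` in `S`, the induced map
`S → Hom(⨂_α g, N₁)`, characterised by `z ↦ (⨂ X ↦ E X z)`. -/
def polarize (E : (α → g) → N₀ →ₗ[ℚ] N₁) (S : Submodule ℚ N₀)
    (h : ∀ z ∈ S, IsMultilin fun X => E X z) : S →ₗ[ℚ] (⨂[ℚ] _ : α, g) →ₗ[ℚ] N₁ where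
  toFun z := PiTensorProduct.lift
    { toFun := fun X => E X z
      map_update_add' := by
        intro inst X a v w
        obtain rfl : hα = inst := Subsingleton.elim _ _
        obtain ⟨l, hl⟩ := h z z.2 X a
        simp only [hl, map_add]
      map_update_smul' := by
        intro inst X a c v
        obtain rfl : hα = inst := Subsingleton.elim _ _
        obtain ⟨l, hl⟩ := h z z.2 X a
        simp only [hl, map_smul] }
  map_add' y z := by
    refine PiTensorProduct.ext (MultilinearMap.ext fun X => ?_)
    simp
  map_smul' c z := by
    refine PiTensorProduct.ext (MultilinearMap.ext fun X => ?_)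
    simp

@[simp] theorem polarize_tprod (E : (α → g) → N₀ →ₗ[ℚ] N₁) (S : Submodule ℚ N₀) (h) (z : S)
    (X : α → g) : polarize E S h z (PiTensorProduct.tprod ℚ X) = E X z := by
  simp [polarize]

theorem isMultilin_forest {ι g : Type*} [Fintype ι] [LieRing g] [LieAlgebra ℚ g] (T : ι → FreeMagma α)
    (hT : ∀ a, (∑ i, leaves (T i)).count a = 1)
    (G : MultilinearMap ℚ (fun _ : ι => g) N) :
    IsMultilin fun X : α → g => G fun i => lieWord X (T i) := by
  classical
  intro X a
  have h := hT a
  rw [Multiset.count_sum'] at h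
  obtain ⟨i, hi⟩ : ∃ i, (leaves (T i)).count a ≠ 0 := by
    by_contra! hne
    simp [hne] at h
  rw [← Finset.add_sum_erase _ _ (Finset.mem_univ i)] at h
  have hi1 : (leaves (T i)).count a = 1 := by omega
  have h0 : ∑ j ∈ Finset.univ.erase i, (leaves (T j)).count a = 0 := by omega
  obtain ⟨l, hl⟩ := lieWord_update_linear X a (T i) hi1
  refine ⟨G.toLinearMap (fun j => lieWord X (T j)) i ∘ₗ l, fun v => ?_⟩
  simp only [LinearMap.comp_apply, MultilinearMap.toLinearMap_apply]
  congr 1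
  funext j
  by_cases hj : j = i
  · subst hj; simp [hl]
  · rw [Function.update_of_ne hj]
    apply lieWord_update_of_notMem
    rw [← Multiset.count_eq_zero]
    exact (Finset.sum_eq_zero_iff.1 h0) j (by simp [hj])

end Polarize

/-! ### The category -/

/-- The multigraded part, of multidegree `A`, of `FreeLie(α)^{⊗ n}`: the span of tensor products
of `n` Lie words in which, in total, each letter occurs as often as it occurs in `A`. -/
def tensSpan {α : Type} (n : ℕ) (A : Multiset α) : Submodule ℚ (Tens n (FreeLieAlgebra ℚ α)) :=
  Submodule.span ℚ {z | ∃ T : Fin n → FreeMagma α, ∑ i, leaves (T i) = A ∧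
    PiTensorProduct.tprod ℚ (fun i => lieWord (FreeLieAlgebra.of ℚ) (T i)) = z}

/-- For a family `X : α → g`, the map `FreeLie(α)^{⊗ n} → g^{⊗ n}` induced by the Lie algebra
morphism `FreeLie(α) → g` that extends `X`. -/
def tensSubst {α g : Type*} [LieRing g] [LieAlgebra ℚ g] (n : ℕ) (X : α → g) :
    Tens n (FreeLieAlgebra ℚ α) →ₗ[ℚ] Tens n g :=
  PiTensorProduct.map fun _ => (FreeLieAlgebra.lift ℚ X : FreeLieAlgebra ℚ α →ₗ[ℚ] g)

/-- `CatLie(m, n)`: the multilinear part of `FreeLie(x_1, …, x_m)^{⊗ n}`, in which each of the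
generators occurs exactly once. -/
abbrev homSpace (m n : ℕ) : Submodule ℚ (Tens n (FreeLieAlgebra ℚ (Fin m))) :=
  tensSpan n (Finset.univ.val : Multiset (Fin m))

section Hom

variable {g h : Type*} [LieRing g] [LieAlgebra ℚ g] [LieRing h] [LieAlgebra ℚ h]

theorem tensSubst_forest {α : Type*} {n : ℕ} (X : α → g) (T : Fin n → FreeMagma α) :
    tensSubst n X (PiTensorProduct.tprod ℚ fun i => lieWord (FreeLieAlgebra.of ℚ) (T i)) =
      PiTensorProduct.tprod ℚ fun i => lieWord X (T i) := by
  simp [tensSubst, lift_lieWord]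

theorem isMultilin_tensSubst {m n : ℕ} :
    ∀ z ∈ homSpace m n, IsMultilin fun X : Fin m → g => tensSubst n X z := by
  refine isMultilin_span _ _ ?_
  rintro z ⟨T, hT, rfl⟩
  simp only [tensSubst_forest]
  exact isMultilin_forest T (fun a => by simp [hT]) _

/-- The action of `CatLie(m, n)` on the tensor powers of a Lie algebra `g`: a multilinear element
`φ` of `FreeLie(x_1, …, x_m)^{⊗ n}` sends `y_1 ⊗ ⋯ ⊗ y_m` to the value of `φ` at `x_i = y_i`. -/
def act (g : Type*) [LieRing g] [LieAlgebra ℚ g] {m n : ℕ} :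
    homSpace m n →ₗ[ℚ] Tens m g →ₗ[ℚ] Tens n g :=
  polarize (tensSubst n) (homSpace m n) isMultilin_tensSubst

@[simp] theorem act_tprod {m n : ℕ} (φ : homSpace m n) (X : Fin m → g) :
    act g φ (PiTensorProduct.tprod ℚ X) = tensSubst n X φ := polarize_tprod _ _ _ _ _

theorem act_mem {α : Type} {m n : ℕ} (φ : homSpace m n) {A : Multiset α}
    {z : Tens m (FreeLieAlgebra ℚ α)} (hz : z ∈ tensSpan m A) :
    act (FreeLieAlgebra ℚ α) φ z ∈ tensSpan n A := by
  obtain ⟨φ, hφ⟩ := φ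
  induction hz using Submodule.span_induction with
  | zero => simp
  | add y z _ _ hy hz => rw [map_add]; exact add_mem hy hz
  | smul c z _ hz => rw [map_smul]; exact Submodule.smul_mem _ c hz
  | mem z hz =>
    obtain ⟨S, hS, rfl⟩ := hz
    rw [act_tprod]
    induction hφ using Submodule.span_induction with
    | zero => simp
    | add y z _ _ hy hz => rw [map_add]; exact add_mem hy hz
    | smul c z _ hz => rw [map_smul]; exact Submodule.smul_mem _ c hz
    | mem φ hφ =>
      obtain ⟨T, hT, rfl⟩ := hφ
      rw [tensSubst_forest]
      refine Submodule.subset_span ⟨fun i => FreeMagma.lift S (T i), ?_, by simp [lieWord_lift]⟩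
      simp only [leaves_lift]
      rw [← hS]
      have : ∀ s : Finset (Fin n), ∑ i ∈ s, (leaves (T i)).bind (fun a => leaves (S a)) =
          (∑ i ∈ s, leaves (T i)).bind (fun a => leaves (S a)) := by
        intro s
        classical
        induction s using Finset.induction_on with
        | empty => simp
        | insert a s ha ih => simp [Finset.sum_insert ha, ih]
      rw [this, hT]
      simp [Multiset.bind, Multiset.join, Finset.sum]

theorem map_act (f : g →ₗ⁅ℚ⁆ h) {m n : ℕ} (φ : homSpace m n) (z : Tens m g) :
    PiTensorProduct.map (fun _ => (f : g →ₗ[ℚ] h)) (act g φ z) =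
      act h φ (PiTensorProduct.map (fun _ => (f : g →ₗ[ℚ] h)) z) := by
  rw [← LinearMap.comp_apply, ← LinearMap.comp_apply]
  congr 1
  refine PiTensorProduct.ext (MultilinearMap.ext fun X => ?_)
  simp only [LinearMap.compMultilinearMap_apply, LinearMap.comp_apply, act_tprod,
    PiTensorProduct.map_tprod]
  simp only [tensSubst, ← LinearMap.comp_apply, ← PiTensorProduct.map_comp]
  congr 2
  funext _
  have : f.comp (FreeLieAlgebra.lift ℚ X) = FreeLieAlgebra.lift ℚ fun i => f (X i) := by
    apply FreeLieAlgebra.hom_ext; simp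
  exact congrArg (fun F : FreeLieAlgebra ℚ (Fin m) →ₗ⁅ℚ⁆ h =>
    (F : FreeLieAlgebra ℚ (Fin m) →ₗ[ℚ] h)) this

/-- Composition in `CatLie`: substitution of the tensor factors of `φ` for the generators in
`ψ`. -/
def homComp {k m n : ℕ} (ψ : homSpace m n) (φ : homSpace k m) : homSpace k n :=
  ⟨act _ ψ φ, act_mem ψ φ.2⟩

theorem act_comp {k m n : ℕ} (ψ : homSpace m n) (φ : homSpace k m) :
    act g (homComp ψ φ) = act g ψ ∘ₗ act g φ := by
  refine PiTensorProduct.ext (MultilinearMap.ext fun X => ?_)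
  simp only [LinearMap.compMultilinearMap_apply, LinearMap.comp_apply, act_tprod]
  exact map_act (FreeLieAlgebra.lift ℚ X) ψ φ

/-- The identity of `n` in `CatLie`: the element `x_1 ⊗ ⋯ ⊗ x_n`. -/
def homId (n : ℕ) : homSpace n n :=
  ⟨PiTensorProduct.tprod ℚ (FreeLieAlgebra.of ℚ), Submodule.subset_span
    ⟨FreeMagma.of, by simp, rfl⟩⟩

@[simp] theorem act_homId (n : ℕ) : act g (homId n) = LinearMap.id := by
  refine PiTensorProduct.ext (MultilinearMap.ext fun X => ?_)
  simp [homId, tensSubst]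

end Hom

/-! ### The Chevalley–Eilenberg complex of a Lie algebra with coefficients in a right module -/

section CE

variable (g : Type*) [LieRing g] [LieAlgebra ℚ g]

/-- The right adjoint action of `g` on `g^{⊗ n}`:
`(y_1 ⊗ ⋯ ⊗ y_n) · x = ∑ i, y_1 ⊗ ⋯ ⊗ [y_i, x] ⊗ ⋯ ⊗ y_n`. -/
def adAct (n : ℕ) : g →ₗ[ℚ] Module.End ℚ (Tens n g) :=
  ∑ i, (PiTensorProduct.mapMultilinear ℚ (fun _ : Fin n => g) fun _ => g).toLinearMap
    (fun _ => LinearMap.id) i ∘ₗ (-(LieAlgebra.ad ℚ g : g →ₗ[ℚ] Module.End ℚ g))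

variable {g}

theorem adAct_eq {n : ℕ} (x : g) : adAct g n x = ∑ i, PiTensorProduct.map
    (Function.update (fun _ => (1 : Module.End ℚ g)) i (-LieAlgebra.ad ℚ g x)) := by
  simp only [adAct, LinearMap.sum_apply]
  rfl

theorem adAct_tprod {n : ℕ} (x : g) (y : Fin n → g) :
    adAct g n x (PiTensorProduct.tprod ℚ y) =
      ∑ i, PiTensorProduct.tprod ℚ (Function.update y i ⁅y i, x⁆) := by
  simp only [adAct_eq, LinearMap.sum_apply, PiTensorProduct.map_tprod]
  refine Finset.sum_congr rfl fun i _ => congrArg _ (funext fun j => ?_)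
  by_cases hj : j = i
  · subst hj; simp
  · simp [Function.update_of_ne hj]

theorem adAct_lie {n : ℕ} (x y : g) :
    adAct g n ⁅x, y⁆ = adAct g n y * adAct g n x - adAct g n x * adAct g n y := by
  simp only [adAct_eq, Finset.sum_mul_sum]
  rw [Finset.sum_comm (s := Finset.univ) (t := Finset.univ)
    (f := fun i j => PiTensorProduct.map (Function.update (fun _ => (1 : Module.End ℚ g)) i
      (-LieAlgebra.ad ℚ g y)) * PiTensorProduct.map (Function.update
        (fun _ => (1 : Module.End ℚ g)) j (-LieAlgebra.ad ℚ g x)))]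
  rw [← Finset.sum_sub_distrib]
  refine Finset.sum_congr rfl fun i _ => ?_
  rw [← Finset.sum_sub_distrib, Finset.sum_eq_single i]
  · simp only [← PiTensorProduct.map_mul]
    have key : ∀ a b : Module.End ℚ g, (fun k => Function.update (fun _ : Fin n =>
        (1 : Module.End ℚ g)) i a k * Function.update (fun _ => (1 : Module.End ℚ g)) i b k) =
        Function.update (fun _ => (1 : Module.End ℚ g)) i (a * b) := by
      intro a b
      funext k
      by_cases hk : k = i
      · subst hk; simp
      · simp [Function.update_of_ne hk]
    rw [key, key, sub_eq_add_neg, ← neg_one_smul ℚ (PiTensorProduct.map _),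
      ← PiTensorProduct.map_update_smul, ← PiTensorProduct.map_update_add]
    congr 2
    have h : LieAlgebra.ad ℚ g ⁅x, y⁆ = LieAlgebra.ad ℚ g x * LieAlgebra.ad ℚ g y -
        LieAlgebra.ad ℚ g y * LieAlgebra.ad ℚ g x := by
      ext z
      simp
    rw [h]
    simp [sub_eq_add_neg]
  · intro j _ hj
    rw [sub_eq_zero, ← PiTensorProduct.map_mul, ← PiTensorProduct.map_mul]
    congr 1
    funext k
    by_cases hk : k = i
    · subst hk; simp [Function.update_of_ne (Ne.symm hj)]
    · simp [Function.update_of_ne hk]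
  · simp

variable (g) in
/-- The extension of the adjoint action `y ↦ [x, y]` to a derivation of the exterior algebra,
`θ_x(y ∧ ω) = [x, y] ∧ ω + y ∧ θ_x(ω)`. -/
def extAd₀ (x : g) : ExteriorAlgebra ℚ g →ₗ[ℚ] ExteriorAlgebra ℚ g :=
  CliffordAlgebra.foldr' 0
    (LinearMap.mk₂ ℚ (fun y p => ExteriorAlgebra.ι ℚ ⁅x, y⁆ * p.1 + ExteriorAlgebra.ι ℚ y * p.2)
      (by intros; simp [add_mul]; abel) (by intros; simp [smul_add])
      (by intros; simp [mul_add]; abel) (by intros; simp [smul_add]))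
    (by
      intro y ω δ
      have h := ExteriorAlgebra.ι_add_mul_swap (R := ℚ) ⁅x, y⁆ y
      simp only [LinearMap.mk₂_apply]
      rw [show (0 : QuadraticForm ℚ g) y • δ = 0 from zero_smul _ _]
      change (ExteriorAlgebra.ι ℚ) ⁅x, y⁆ * (ExteriorAlgebra.ι ℚ y * ω) + ExteriorAlgebra.ι ℚ y *
        (ExteriorAlgebra.ι ℚ ⁅x, y⁆ * ω + ExteriorAlgebra.ι ℚ y * δ) = 0
      rw [mul_add, ← add_assoc, ← mul_assoc, ← mul_assoc, ← add_mul, h, ← mul_assoc,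
        ExteriorAlgebra.ι_sq_zero]
      simp) 0

theorem extAd₀_ι_mul (x y : g) (ω : ExteriorAlgebra ℚ g) :
    extAd₀ g x (ExteriorAlgebra.ι ℚ y * ω) =
      ExteriorAlgebra.ι ℚ ⁅x, y⁆ * ω + ExteriorAlgebra.ι ℚ y * extAd₀ g x ω :=
  CliffordAlgebra.foldr'_ι_mul _ _ _ _ _ _

theorem extAd₀_algebraMap (x : g) (r : ℚ) :
    extAd₀ g x (algebraMap ℚ (ExteriorAlgebra ℚ g) r) = 0 :=
  (CliffordAlgebra.foldr'_algebraMap _ _ _ _ _).trans (smul_zero _)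

theorem ext_induction {P : ExteriorAlgebra ℚ g → Prop}
    (h0 : ∀ r : ℚ, P (algebraMap ℚ _ r)) (hadd : ∀ x y, P x → P y → P (x + y))
    (hι : ∀ y ω, P ω → P (ExteriorAlgebra.ι ℚ y * ω)) (ω) : P ω :=
  CliffordAlgebra.left_induction (Q := (0 : QuadraticForm ℚ g)) h0 hadd (fun ω y h => hι y ω h) ω

variable (g) in
/-- The derivations `θ_x`, as a linear function of `x`. -/
def extAd : g →ₗ[ℚ] Module.End ℚ (ExteriorAlgebra ℚ g) where
  toFun := extAd₀ g
  map_add' x y := by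
    refine LinearMap.ext fun ω => ?_
    induction ω using ext_induction with
    | h0 r => simp [extAd₀_algebraMap]
    | hadd a b ha hb => simp only [map_add, ha, hb]
    | hι z ω h => simp [extAd₀_ι_mul, h, mul_add, add_mul]; abel
  map_smul' c x := by
    refine LinearMap.ext fun ω => ?_
    induction ω using ext_induction with
    | h0 r => simp [extAd₀_algebraMap]
    | hadd a b ha hb => simp only [map_add, ha, hb]
    | hι z ω h => simp [extAd₀_ι_mul, h]

theorem extAd_ι_mul (x y : g) (ω : ExteriorAlgebra ℚ g) :
    extAd g x (ExteriorAlgebra.ι ℚ y * ω) =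
      ExteriorAlgebra.ι ℚ ⁅x, y⁆ * ω + ExteriorAlgebra.ι ℚ y * extAd g x ω :=
  extAd₀_ι_mul x y ω

@[simp] theorem extAd_algebraMap (x : g) (r : ℚ) :
    extAd g x (algebraMap ℚ (ExteriorAlgebra ℚ g) r) = 0 := extAd₀_algebraMap x r

@[simp] theorem extAd_one (x : g) : extAd g x (1 : ExteriorAlgebra ℚ g) = 0 := by
  rw [← map_one (algebraMap ℚ (ExteriorAlgebra ℚ g)), extAd_algebraMap]

theorem extAd_lie (x y : g) (ω : ExteriorAlgebra ℚ g) :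
    extAd g ⁅x, y⁆ ω = extAd g x (extAd g y ω) - extAd g y (extAd g x ω) := by
  induction ω using ext_induction with
  | h0 r => simp
  | hadd a b ha hb => simp only [map_add, ha, hb]; abel
  | hι z ω h =>
    simp only [extAd_ι_mul, h, map_add, lie_lie, map_sub, mul_sub, sub_mul]
    abel

variable {M N : Type*} [AddCommGroup M] [Module ℚ M] [AddCommGroup N] [Module ℚ N]

/-- Exterior multiplication `m ⊗ ω ↦ m ⊗ (x ∧ ω)` on `M ⊗ Λ(g)`. -/
def wedge (M : Type*) [AddCommGroup M] [Module ℚ M] (x : g) :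
    M ⊗[ℚ] ExteriorAlgebra ℚ g →ₗ[ℚ] M ⊗[ℚ] ExteriorAlgebra ℚ g :=
  LinearMap.lTensor M (LinearMap.mulLeft ℚ (ExteriorAlgebra.ι ℚ x))

@[simp] theorem wedge_tmul (x : g) (m : M) (ω : ExteriorAlgebra ℚ g) :
    wedge M x (m ⊗ₜ ω) = m ⊗ₜ (ExteriorAlgebra.ι ℚ x * ω) := rfl

theorem wedge_add (x y : g) : wedge M (x + y) = wedge M x + wedge M y := by
  refine TensorProduct.ext' fun m ω => ?_
  simp [add_mul, tmul_add]

theorem wedge_smul (c : ℚ) (x : g) : wedge M (c • x) = c • wedge M x := by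
  refine TensorProduct.ext' fun m ω => ?_
  simp

theorem wedge_wedge (x : g) (z : M ⊗[ℚ] ExteriorAlgebra ℚ g) : wedge M x (wedge M x z) = 0 := by
  induction z with
  | zero => simp
  | add a b ha hb => simp [ha, hb]
  | tmul m ω => simp [← mul_assoc]

/-- For `ω` in `Λ(g)`, the map `m ↦ d(m ⊗ ω)`, where `d` is the Chevalley–Eilenberg differential. -/
def ceD₀ (ρ : g →ₗ[ℚ] Module.End ℚ M) :
    ExteriorAlgebra ℚ g →ₗ[ℚ] (M →ₗ[ℚ] M ⊗[ℚ] ExteriorAlgebra ℚ g) :=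
  CliffordAlgebra.foldr' 0
    (LinearMap.mk₂ ℚ (fun x (p : ExteriorAlgebra ℚ g × (M →ₗ[ℚ] M ⊗[ℚ] ExteriorAlgebra ℚ g)) =>
        (TensorProduct.mk ℚ M (ExteriorAlgebra ℚ g)).flip p.1 ∘ₗ ρ x
          - (TensorProduct.mk ℚ M (ExteriorAlgebra ℚ g)).flip (extAd g x p.1)
          - wedge M x ∘ₗ p.2)
      (by
        intro x y p
        refine LinearMap.ext fun m => ?_
        simp [wedge_add]; abel)
      (by
        intro c x p
        refine LinearMap.ext fun m => ?_
        simp [wedge_smul, smul_sub, smul_tmul'])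
      (by
        intro x p q
        refine LinearMap.ext fun m => ?_
        simp; abel)
      (by
        intro c x p
        refine LinearMap.ext fun m => ?_
        simp [smul_sub]))
    (by
      intro x ω δ
      refine LinearMap.ext fun m => ?_
      simp only [LinearMap.mk₂_apply, LinearMap.sub_apply,
        LinearMap.comp_apply, LinearMap.flip_apply, TensorProduct.mk_apply, map_sub, wedge_wedge,
        wedge_tmul]
      erw [extAd_ι_mul]
      simp) 0

/-- The Chevalley–Eilenberg differential on `M ⊗ Λ(g)`, for `M` a right `g`-module with action
`m · x = ρ x m`. It is determined by `d(m ⊗ 1) = 0` and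
`d(m ⊗ (x ∧ ω)) = (m · x) ⊗ ω - m ⊗ θ_x(ω) - x ∧ d(m ⊗ ω)`. -/
def ceD (ρ : g →ₗ[ℚ] Module.End ℚ M) :
    M ⊗[ℚ] ExteriorAlgebra ℚ g →ₗ[ℚ] M ⊗[ℚ] ExteriorAlgebra ℚ g :=
  TensorProduct.lift (ceD₀ ρ).flip

theorem ceD_wedge_tmul (ρ : g →ₗ[ℚ] Module.End ℚ M) (x : g) (m : M) (ω : ExteriorAlgebra ℚ g) :
    ceD ρ (m ⊗ₜ (ExteriorAlgebra.ι ℚ x * ω)) =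
      ρ x m ⊗ₜ ω - m ⊗ₜ extAd g x ω - wedge M x (ceD ρ (m ⊗ₜ ω)) := by
  simp only [ceD, TensorProduct.lift.tmul, LinearMap.flip_apply]
  exact LinearMap.congr_fun (CliffordAlgebra.foldr'_ι_mul _ _ _ _ _ _) m

@[simp] theorem ceD_algebraMap (ρ : g →ₗ[ℚ] Module.End ℚ M) (m : M) (r : ℚ) :
    ceD ρ (m ⊗ₜ algebraMap ℚ _ r) = 0 := by
  simp only [ceD, TensorProduct.lift.tmul, LinearMap.flip_apply]
  rw [show ceD₀ ρ (algebraMap ℚ _ r) = 0 from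
    (CliffordAlgebra.foldr'_algebraMap _ _ _ _ _).trans (smul_zero _)]
  rfl

@[simp] theorem ceD_one (ρ : g →ₗ[ℚ] Module.End ℚ M) (m : M) :
    ceD ρ (m ⊗ₜ (1 : ExteriorAlgebra ℚ g)) = 0 := by
  rw [← map_one (algebraMap ℚ (ExteriorAlgebra ℚ g)), ceD_algebraMap]

/-- Degree one: `d(m ⊗ x) = m · x`. -/
theorem ceD_ι (ρ : g →ₗ[ℚ] Module.End ℚ M) (m : M) (x : g) :
    ceD ρ (m ⊗ₜ ExteriorAlgebra.ι ℚ x) = ρ x m ⊗ₜ 1 := by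
  simpa using ceD_wedge_tmul ρ x m 1

/-- Degree two: `d(m ⊗ (x ∧ y)) = m · x ⊗ y - m · y ⊗ x - m ⊗ [x, y]`. -/
theorem ceD_ι_mul_ι (ρ : g →ₗ[ℚ] Module.End ℚ M) (m : M) (x y : g) :
    ceD ρ (m ⊗ₜ (ExteriorAlgebra.ι ℚ x * ExteriorAlgebra.ι ℚ y)) =
      ρ x m ⊗ₜ ExteriorAlgebra.ι ℚ y - ρ y m ⊗ₜ ExteriorAlgebra.ι ℚ x
        - m ⊗ₜ ExteriorAlgebra.ι ℚ ⁅x, y⁆ := by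
  have h := extAd_ι_mul x y (1 : ExteriorAlgebra ℚ g)
  simp only [mul_one, extAd_one, mul_zero, add_zero] at h
  rw [ceD_wedge_tmul, ceD_ι, h, wedge_tmul, mul_one]
  abel

/-- The action of `x` on `M ⊗ Λ(g)`. -/
def totAct (ρ : g →ₗ[ℚ] Module.End ℚ M) (x : g) :
    M ⊗[ℚ] ExteriorAlgebra ℚ g →ₗ[ℚ] M ⊗[ℚ] ExteriorAlgebra ℚ g :=
  LinearMap.rTensor _ (ρ x) - LinearMap.lTensor _ (extAd g x)

theorem ceD_wedge (ρ : g →ₗ[ℚ] Module.End ℚ M) (x : g) (z : M ⊗[ℚ] ExteriorAlgebra ℚ g) :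
    ceD ρ (wedge M x z) = totAct ρ x z - wedge M x (ceD ρ z) := by
  induction z with
  | zero => simp
  | add a b ha hb => simp only [map_add, ha, hb]; abel
  | tmul m ω => rw [wedge_tmul, ceD_wedge_tmul]; rfl

theorem totAct_wedge (ρ : g →ₗ[ℚ] Module.End ℚ M) (x y : g) (z : M ⊗[ℚ] ExteriorAlgebra ℚ g) :
    totAct ρ x (wedge M y z) = wedge M y (totAct ρ x z) - wedge M ⁅x, y⁆ z := by
  induction z with
  | zero => simp
  | add a b ha hb => simp only [map_add, ha, hb]; abel
  | tmul m ω => simp [totAct, extAd_ι_mul, tmul_add]; abel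

theorem tensor_induction {P : M ⊗[ℚ] ExteriorAlgebra ℚ g → Prop}
    (h0 : ∀ m, P (m ⊗ₜ 1)) (hadd : ∀ x y, P x → P y → P (x + y))
    (hι : ∀ y z, P z → P (wedge M y z)) (z) : P z := by
  induction z with
  | zero => simpa using h0 0
  | add a b ha hb => exact hadd a b ha hb
  | tmul m ω =>
    induction ω using ext_induction with
    | h0 r =>
      rw [Algebra.algebraMap_eq_smul_one, ← smul_tmul]
      exact h0 _
    | hadd a b ha hb => rw [tmul_add]; exact hadd _ _ ha hb
    | hι y ω h => exact hι y _ h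

theorem totAct_lie (ρ : g →ₗ[ℚ] Module.End ℚ M)
    (hρ : ∀ x y, ρ ⁅x, y⁆ = ρ y * ρ x - ρ x * ρ y) (x y : g) (z : M ⊗[ℚ] ExteriorAlgebra ℚ g) :
    totAct ρ ⁅x, y⁆ z = totAct ρ y (totAct ρ x z) - totAct ρ x (totAct ρ y z) := by
  induction z with
  | zero => simp
  | add a b ha hb => simp only [map_add, ha, hb]; abel
  | tmul m ω => simp [totAct, extAd_lie, hρ, tmul_sub]; abel

theorem ceD_totAct (ρ : g →ₗ[ℚ] Module.End ℚ M)
    (hρ : ∀ x y, ρ ⁅x, y⁆ = ρ y * ρ x - ρ x * ρ y) (x : g) (z : M ⊗[ℚ] ExteriorAlgebra ℚ g) :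
    ceD ρ (totAct ρ x z) = totAct ρ x (ceD ρ z) := by
  induction z using tensor_induction with
  | h0 m => simp [totAct]
  | hadd a b ha hb => simp only [map_add, ha, hb]
  | hι y z h =>
    have h1 := totAct_lie ρ hρ x y z
    simp only [totAct_wedge, ceD_wedge, map_sub, h, h1]
    abel

theorem ceD_ceD (ρ : g →ₗ[ℚ] Module.End ℚ M)
    (hρ : ∀ x y, ρ ⁅x, y⁆ = ρ y * ρ x - ρ x * ρ y) (z : M ⊗[ℚ] ExteriorAlgebra ℚ g) :
    ceD ρ (ceD ρ z) = 0 := by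
  induction z using tensor_induction with
  | h0 m => simp
  | hadd a b ha hb => simp only [map_add, ha, hb, add_zero]
  | hι y z h => simp [ceD_wedge, ceD_totAct ρ hρ, h]

variable {h : Type*} [LieRing h] [LieAlgebra ℚ h]

/-- Naturality of the Chevalley–Eilenberg differential. -/
theorem ceD_map (ρ : g →ₗ[ℚ] Module.End ℚ M) (σ : h →ₗ[ℚ] Module.End ℚ N) (f : g →ₗ⁅ℚ⁆ h)
    (F : M →ₗ[ℚ] N) (hF : ∀ x m, F (ρ x m) = σ (f x) (F m)) (z : M ⊗[ℚ] ExteriorAlgebra ℚ g) :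
    TensorProduct.map F (ExteriorAlgebra.map (f : g →ₗ[ℚ] h)).toLinearMap (ceD ρ z) =
      ceD σ (TensorProduct.map F (ExteriorAlgebra.map (f : g →ₗ[ℚ] h)).toLinearMap z) := by
  set G := TensorProduct.map F (ExteriorAlgebra.map (f : g →ₗ[ℚ] h)).toLinearMap with hG
  have hw : ∀ x z, G (wedge M x z) = wedge N (f x) (G z) := by
    intro x z
    induction z with
    | zero => simp
    | add a b ha hb => simp only [map_add, ha, hb]
    | tmul m ω => simp [hG]
  have he : ∀ x ω, ExteriorAlgebra.map (f : g →ₗ[ℚ] h) (extAd g x ω) =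
      extAd h (f x) (ExteriorAlgebra.map (f : g →ₗ[ℚ] h) ω) := by
    intro x ω
    induction ω using ext_induction with
    | h0 r => simp
    | hadd a b ha hb => simp only [map_add, ha, hb]
    | hι y ω hω => simp [extAd_ι_mul, hω]
  have ht : ∀ x z, G (totAct ρ x z) = totAct σ (f x) (G z) := by
    intro x z
    induction z with
    | zero => simp
    | add a b ha hb => simp only [map_add, ha, hb]
    | tmul m ω => simp [hG, totAct, hF, he]
  induction z using tensor_induction with
  | h0 m => simp [hG]
  | hadd a b ha hb => simp only [map_add, ha, hb]
  | hι y z hz => simp [ceD_wedge, hw, ht, hz]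

end CE

/-! ### The bimodules of the universal Chevalley–Eilenberg complex -/

section Spans

variable {α : Type}

/-- The multigraded part, of multidegree `A`, of `FreeLie(α)^{⊗ n} ⊗ Λ^t(FreeLie(α))`. -/
def ceSpan (n t : ℕ) (A : Multiset α) :
    Submodule ℚ (Tens n (FreeLieAlgebra ℚ α) ⊗[ℚ] ExteriorAlgebra ℚ (FreeLieAlgebra ℚ α)) :=
  Submodule.span ℚ {z | ∃ (T : Fin n → FreeMagma α) (U : Fin t → FreeMagma α),
    ∑ i, leaves (T i) + ∑ j, leaves (U j) = A ∧
    PiTensorProduct.tprod ℚ (fun i => lieWord (FreeLieAlgebra.of ℚ) (T i)) ⊗ₜ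
      ExteriorAlgebra.ιMulti ℚ t (fun j => lieWord (FreeLieAlgebra.of ℚ) (U j)) = z}

theorem adAct_mem {n : ℕ} {A : Multiset α} (U : FreeMagma α) {z} (hz : z ∈ tensSpan n A) :
    adAct (FreeLieAlgebra ℚ α) n (lieWord (FreeLieAlgebra.of ℚ) U) z ∈
      tensSpan n (A + leaves U) := by
  induction hz using Submodule.span_induction with
  | zero => simp
  | add y z _ _ hy hz => rw [map_add]; exact add_mem hy hz
  | smul c z _ hz => rw [map_smul]; exact Submodule.smul_mem _ c hz
  | mem z hz =>
    obtain ⟨T, rfl, rfl⟩ := hz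
    rw [adAct_tprod]
    refine sum_mem fun i _ => Submodule.subset_span ⟨Function.update T i (T i * U), ?_, ?_⟩
    · rw [← Finset.add_sum_erase _ _ (Finset.mem_univ i),
        ← Finset.add_sum_erase _ _ (Finset.mem_univ i)]
      rw [Finset.sum_congr rfl (g := fun j => leaves (T j))]
      · simp only [Function.update_self, leaves_mul]
        abel
      · intro j hj
        rw [Function.update_of_ne (Finset.ne_of_mem_erase hj)]
    · congr 1
      funext j
      by_cases hj : j = i
      · subst hj; simp
      · simp [Function.update_of_ne hj]

theorem wedge_mem {n t : ℕ} {A : Multiset α} (U : FreeMagma α) {z} (hz : z ∈ ceSpan n t A) :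
    wedge _ (lieWord (FreeLieAlgebra.of ℚ) U) z ∈ ceSpan n (t + 1) (A + leaves U) := by
  induction hz using Submodule.span_induction with
  | zero => simp
  | add y z _ _ hy hz => rw [map_add]; exact add_mem hy hz
  | smul c z _ hz => rw [map_smul]; exact Submodule.smul_mem _ c hz
  | mem z hz =>
    obtain ⟨T, V, rfl, rfl⟩ := hz
    refine Submodule.subset_span ⟨T, Fin.cons U V, ?_, ?_⟩
    · rw [Fin.sum_univ_succ]
      simp only [Fin.cons_zero, Fin.cons_succ]
      abel
    · rw [wedge_tmul, ExteriorAlgebra.ιMulti_succ_apply]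
      rfl

/-- A generator of `ceSpan n (t + 1) A` is of the form `x ∧ z` with `z` a generator. -/
theorem ceSpan_succ_induction {n t : ℕ} {A : Multiset α}
    {P : Tens n (FreeLieAlgebra ℚ α) ⊗[ℚ] ExteriorAlgebra ℚ (FreeLieAlgebra ℚ α) → Prop}
    (h0 : P 0) (hadd : ∀ x y, P x → P y → P (x + y)) (hsmul : ∀ (c : ℚ) x, P x → P (c • x))
    (hw : ∀ (U : FreeMagma α) (B : Multiset α) (z), B + leaves U = A → z ∈ ceSpan n t B →
      P (wedge _ (lieWord (FreeLieAlgebra.of ℚ) U) z)) {z} (hz : z ∈ ceSpan n (t + 1) A) : P z := by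
  induction hz using Submodule.span_induction with
  | zero => exact h0
  | add y z _ _ hy hz => exact hadd _ _ hy hz
  | smul c z _ hz => exact hsmul c _ hz
  | mem z hz =>
    obtain ⟨T, V, hA, rfl⟩ := hz
    rw [ExteriorAlgebra.ιMulti_succ_apply]
    refine hw (V 0) (∑ i, leaves (T i) + ∑ j : Fin t, leaves (V j.succ)) (_ ⊗ₜ _) ?_
      (Submodule.subset_span ⟨T, fun j => V j.succ, rfl, rfl⟩)
    rw [← hA, Fin.sum_univ_succ]
    abel

theorem ceSpan_zero_induction {n : ℕ} {A : Multiset α}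
    {P : Tens n (FreeLieAlgebra ℚ α) ⊗[ℚ] ExteriorAlgebra ℚ (FreeLieAlgebra ℚ α) → Prop}
    (h : ∀ y ∈ tensSpan n A, P (y ⊗ₜ 1)) {z} (hz : z ∈ ceSpan n 0 A) : P z := by
  suffices h' : ∃ y ∈ tensSpan n A, y ⊗ₜ[ℚ] (1 : ExteriorAlgebra ℚ (FreeLieAlgebra ℚ α)) = z by
    obtain ⟨y, hy, rfl⟩ := h'
    exact h y hy
  induction hz using Submodule.span_induction with
  | zero => exact ⟨0, zero_mem _, by simp⟩
  | add y z _ _ hy hz =>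
    obtain ⟨a, ha, rfl⟩ := hy
    obtain ⟨b, hb, rfl⟩ := hz
    exact ⟨a + b, add_mem ha hb, add_tmul _ _ _⟩
  | smul c z _ hz =>
    obtain ⟨b, hb, rfl⟩ := hz
    exact ⟨c • b, Submodule.smul_mem _ c hb, rfl⟩
  | mem z hz =>
    obtain ⟨T, V, hA, rfl⟩ := hz
    exact ⟨_, Submodule.subset_span ⟨T, by simpa using hA, rfl⟩, by simp⟩

theorem totAct_mem {n t : ℕ} {A : Multiset α} (U : FreeMagma α) {z} (hz : z ∈ ceSpan n t A) :
    totAct (adAct _ n) (lieWord (FreeLieAlgebra.of ℚ) U) z ∈ ceSpan n t (A + leaves U) := by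
  induction t generalizing A z with
  | zero =>
    refine ceSpan_zero_induction (P := fun z => totAct (adAct _ n)
      (lieWord (FreeLieAlgebra.of ℚ) U) z ∈ ceSpan n 0 (A + leaves U)) (fun y hy => ?_) hz
    · have h2 : ∀ x ∈ tensSpan n (A + leaves U),
          x ⊗ₜ[ℚ] (1 : ExteriorAlgebra ℚ (FreeLieAlgebra ℚ α)) ∈ ceSpan n 0 (A + leaves U) := by
        intro x hx
        induction hx using Submodule.span_induction with
        | zero => simp
        | add y z _ _ hy hz => rw [add_tmul]; exact add_mem hy hz
        | smul c z _ hz => rw [← smul_tmul']; exact Submodule.smul_mem _ c hz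
        | mem z hz =>
          obtain ⟨T, hA, rfl⟩ := hz
          exact Submodule.subset_span ⟨T, Fin.elim0, by simpa using hA, by simp⟩
      have := h2 _ (adAct_mem U hy)
      simpa [totAct] using this
  | succ t ih =>
    refine ceSpan_succ_induction (P := fun z => totAct (adAct _ n)
        (lieWord (FreeLieAlgebra.of ℚ) U) z ∈ ceSpan n (t + 1) (A + leaves U))
      (by simp) (fun x y hx hy => ?_) (fun c x hx => ?_) (fun V B w hB hw => ?_) hz
    · rw [map_add]; exact add_mem hx hy
    · rw [map_smul]; exact Submodule.smul_mem _ c hx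
    · subst hB
      rw [totAct_wedge]
      refine sub_mem ?_ ?_
      · have := wedge_mem V (ih hw)
        rwa [add_right_comm] at this
      · have := wedge_mem (U * V) hw
        rw [leaves_mul, ← add_assoc, add_right_comm] at this
        exact this

theorem ceD_mem {n t : ℕ} {A : Multiset α} {z} (hz : z ∈ ceSpan n (t + 1) A) :
    ceD (adAct (FreeLieAlgebra ℚ α) n) z ∈ ceSpan n t A := by
  induction t generalizing A z with
  | zero =>
    refine ceSpan_succ_induction (P := fun z => ceD (adAct (FreeLieAlgebra ℚ α) n) z ∈ ceSpan n 0 A)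
      (by simp) (fun x y hx hy => ?_) (fun c x hx => ?_) (fun V B w hB hw => ?_) hz
    · rw [map_add]; exact add_mem hx hy
    · rw [map_smul]; exact Submodule.smul_mem _ c hx
    · subst hB
      rw [ceD_wedge]
      refine sub_mem (totAct_mem V hw) ?_
      refine ceSpan_zero_induction (P := fun z => wedge _ (lieWord (FreeLieAlgebra.of ℚ) V)
        (ceD (adAct (FreeLieAlgebra ℚ α) n) z) ∈ ceSpan n 0 (B + leaves V)) (fun y hy => ?_) hw
      simp
  | succ t ih =>
    refine ceSpan_succ_induction (P := fun z => ceD (adAct (FreeLieAlgebra ℚ α) n) z ∈ ceSpan n (t + 1) A)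
      (by simp) (fun x y hx hy => ?_) (fun c x hx => ?_) (fun V B w hB hw => ?_) hz
    · rw [map_add]; exact add_mem hx hy
    · rw [map_smul]; exact Submodule.smul_mem _ c hx
    · subst hB
      rw [ceD_wedge]
      exact sub_mem (totAct_mem V hw) (wedge_mem V (ih hw))

end Spans

section CEBimodule

variable {g h : Type*} [LieRing g] [LieAlgebra ℚ g] [LieRing h] [LieAlgebra ℚ h]

/-- The map `g^{⊗ n} ⊗ Λ(g) → h^{⊗ n} ⊗ Λ(h)` induced by a Lie algebra morphism. -/
def ceMap (n : ℕ) (f : g →ₗ⁅ℚ⁆ h) :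
    Tens n g ⊗[ℚ] ExteriorAlgebra ℚ g →ₗ[ℚ] Tens n h ⊗[ℚ] ExteriorAlgebra ℚ h :=
  TensorProduct.map (PiTensorProduct.map fun _ => (f : g →ₗ[ℚ] h))
    (ExteriorAlgebra.map (f : g →ₗ[ℚ] h)).toLinearMap

theorem map_adAct {n : ℕ} (f : g →ₗ⁅ℚ⁆ h) (x : g) (z : Tens n g) :
    PiTensorProduct.map (fun _ => (f : g →ₗ[ℚ] h)) (adAct g n x z) =
      adAct h n (f x) (PiTensorProduct.map (fun _ => (f : g →ₗ[ℚ] h)) z) := by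
  rw [← LinearMap.comp_apply, ← LinearMap.comp_apply]
  congr 1
  refine PiTensorProduct.ext (MultilinearMap.ext fun y => ?_)
  simp only [LinearMap.compMultilinearMap_apply, LinearMap.comp_apply, adAct_tprod, map_sum,
    PiTensorProduct.map_tprod]
  refine Finset.sum_congr rfl fun i _ => congrArg _ (funext fun j => ?_)
  by_cases hj : j = i
  · subst hj; simp
  · simp [Function.update_of_ne hj]

theorem ceD_ceMap {n : ℕ} (f : g →ₗ⁅ℚ⁆ h) (z : Tens n g ⊗[ℚ] ExteriorAlgebra ℚ g) :
    ceMap n f (ceD (adAct g n) z) = ceD (adAct h n) (ceMap n f z) :=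
  ceD_map _ _ f _ (map_adAct f) z

theorem lie_lieWord {α : Type*} [DecidableEq α] (X : α → g) (x : g) (T : FreeMagma α)
    (hT : (leaves T).Nodup) :
    ⁅lieWord X T, x⁆ = ∑ a ∈ (leaves T).toFinset, lieWord (Function.update X a ⁅X a, x⁆) T := by
  induction T with
  | ih1 a => simp
  | ih2 s t hs ht =>
    rw [leaves_mul] at hT ⊢
    obtain ⟨h1, h2, h3⟩ := Multiset.nodup_add.1 hT
    rw [Multiset.toFinset_add, Finset.sum_union (by rwa [Multiset.disjoint_toFinset])]
    have e1 : ∀ a ∈ (leaves s).toFinset, lieWord (Function.update X a ⁅X a, x⁆) (s * t) =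
        ⁅lieWord (Function.update X a ⁅X a, x⁆) s, lieWord X t⁆ := by
      intro a ha
      rw [lieWord_mul, lieWord_update_of_notMem X a _ t
        (Multiset.disjoint_left.1 h3 (Multiset.mem_toFinset.1 ha))]
    have e2 : ∀ a ∈ (leaves t).toFinset, lieWord (Function.update X a ⁅X a, x⁆) (s * t) =
        ⁅lieWord X s, lieWord (Function.update X a ⁅X a, x⁆) t⁆ := by
      intro a ha
      rw [lieWord_mul, lieWord_update_of_notMem X a _ s
        (Multiset.disjoint_right.1 h3 (Multiset.mem_toFinset.1 ha))]
    rw [Finset.sum_congr rfl e1, Finset.sum_congr rfl e2, ← sum_lie, ← lie_sum,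
      ← hs h1, ← ht h2, lieWord_mul, lie_lie]
    rw [← lie_skew ⁅lieWord X s, x⁆ (lieWord X t)]
    abel

/-- The action of `CatLie` on tensor powers commutes with the adjoint action. -/
theorem act_adAct {m n : ℕ} (φ : homSpace m n) (x : g) (z : Tens m g) :
    act g φ (adAct g m x z) = adAct g n x (act g φ z) := by
  rw [← LinearMap.comp_apply, ← LinearMap.comp_apply]
  congr 1
  refine PiTensorProduct.ext (MultilinearMap.ext fun X => ?_)
  simp only [LinearMap.compMultilinearMap_apply, LinearMap.comp_apply, adAct_tprod, map_sum,
    act_tprod]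
  obtain ⟨φ, hφ⟩ := φ
  dsimp only
  induction hφ using Submodule.span_induction with
  | zero => simp
  | add y z _ _ hy hz => simp only [map_add, Finset.sum_add_distrib, hy, hz]
  | smul c z _ hz => simp only [map_smul, ← Finset.smul_sum, hz]
  | mem φ hφ =>
    obtain ⟨T, hT, rfl⟩ := hφ
    simp only [tensSubst_forest, adAct_tprod]
    have hle : ∀ i, leaves (T i) ≤ ∑ i, leaves (T i) := fun i =>
      Finset.single_le_sum (f := fun i => leaves (T i)) (fun _ _ => Multiset.zero_le _)
        (Finset.mem_univ i)
    have hnd : ∀ i, (leaves (T i)).Nodup := fun i =>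
      Multiset.nodup_of_le (hle i) (hT ▸ Finset.univ.nodup)
    have hone : ∀ a, ∑ i, (leaves (T i)).count a = 1 := by
      intro a
      rw [← Multiset.count_sum', hT]
      simp
    have huniq : ∀ a i j, a ∈ leaves (T i) → j ≠ i → a ∉ leaves (T j) := by
      intro a i j hi hj hj'
      have h := hone a
      rw [← Finset.add_sum_erase _ _ (Finset.mem_univ i)] at h
      have h1 := Multiset.one_le_count_iff_mem.2 hi
      have h2 : (leaves (T j)).count a ≤ ∑ k ∈ Finset.univ.erase i, (leaves (T k)).count a :=
        Finset.single_le_sum (f := fun k => (leaves (T k)).count a) (fun _ _ => Nat.zero_le _)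
          (by simp [hj])
      have h3 := Multiset.one_le_count_iff_mem.2 hj'
      omega
    have key : ∀ i, PiTensorProduct.tprod ℚ (Function.update (fun i => lieWord X (T i)) i
        ⁅lieWord X (T i), x⁆) = ∑ a, if a ∈ leaves (T i) then
          PiTensorProduct.tprod ℚ (fun j => lieWord (Function.update X a ⁅X a, x⁆) (T j))
          else 0 := by
      intro i
      rw [lie_lieWord X x (T i) (hnd i), MultilinearMap.map_update_sum, ← Finset.sum_filter]
      refine Finset.sum_congr (by ext a; simp) fun a ha => congrArg _ (funext fun j => ?_)
      by_cases hj : j = i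
      · subst hj; simp
      · rw [Function.update_of_ne hj, lieWord_update_of_notMem]
        exact huniq a i j (by simpa using ha) hj
    rw [Finset.sum_congr rfl fun i _ => key i, Finset.sum_comm]
    refine Finset.sum_congr rfl fun a _ => ?_
    obtain ⟨i, hi⟩ : ∃ i, a ∈ leaves (T i) := by
      by_contra! hne
      have h := hone a
      simp [Multiset.count_eq_zero.2 (hne _)] at h
    rw [Finset.sum_eq_single i]
    · simp [hi]
    · intro j _ hj
      simp [huniq a i j hi hj]
    · simp

/-- The value at a family `X : α → g` of an element of `FreeLie(α)^{⊗ n} ⊗ Λ(FreeLie(α))`. -/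
def ceSubst {α : Type*} (n : ℕ) (X : α → g) :
    Tens n (FreeLieAlgebra ℚ α) ⊗[ℚ] ExteriorAlgebra ℚ (FreeLieAlgebra ℚ α) →ₗ[ℚ]
      Tens n g ⊗[ℚ] ExteriorAlgebra ℚ g :=
  ceMap n (FreeLieAlgebra.lift ℚ X)

theorem ceSubst_forest {α : Type*} {n t : ℕ} (X : α → g) (T : Fin n → FreeMagma α)
    (U : Fin t → FreeMagma α) :
    ceSubst n X (PiTensorProduct.tprod ℚ (fun i => lieWord (FreeLieAlgebra.of ℚ) (T i)) ⊗ₜ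
      ExteriorAlgebra.ιMulti ℚ t (fun j => lieWord (FreeLieAlgebra.of ℚ) (U j))) =
    PiTensorProduct.tprod ℚ (fun i => lieWord X (T i)) ⊗ₜ
      ExteriorAlgebra.ιMulti ℚ t (fun j => lieWord X (U j)) := by
  simp [ceSubst, ceMap, ExteriorAlgebra.map_apply_ιMulti, lift_lieWord, Function.comp_def]

/-- The term `CE_t(m, n) = (CatLie(-, n) ⊙ Λ^t Lie)(m)` of the universal Chevalley–Eilenberg
complex: the part of `FreeLie(x_1, …, x_m)^{⊗ n} ⊗ Λ^t(FreeLie(x_1, …, x_m))` in which each of the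
generators occurs exactly once. -/
abbrev ceSpace (t m n : ℕ) : Submodule ℚ (Tens n (FreeLieAlgebra ℚ (Fin m)) ⊗[ℚ]
    ExteriorAlgebra ℚ (FreeLieAlgebra ℚ (Fin m))) :=
  ceSpan n t (Finset.univ.val : Multiset (Fin m))

theorem isMultilin_ceSubst {t m n : ℕ} :
    ∀ z ∈ ceSpace t m n, IsMultilin fun X : Fin m → g => ceSubst n X z := by
  refine isMultilin_span _ _ ?_
  rintro z ⟨T, U, hT, rfl⟩
  simp only [ceSubst_forest]
  exact isMultilin_forest (Sum.elim T U) (fun a => by simp [hT])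
    ((PiTensorProduct.tprod ℚ : MultilinearMap ℚ (fun _ : Fin n => g) _).domCoprod
      (ExteriorAlgebra.ιMulti ℚ t : g [⋀^Fin t]→ₗ[ℚ] _).toMultilinearMap)

/-- For `z` in `CE_t(m, n)`, the linear map `g^{⊗ m} → g^{⊗ n} ⊗ Λ(g)` that sends
`y_1 ⊗ ⋯ ⊗ y_m` to the value of `z` at `x_i = y_i`. -/
def ceAct (g : Type*) [LieRing g] [LieAlgebra ℚ g] {t m n : ℕ} :
    ceSpace t m n →ₗ[ℚ] Tens m g →ₗ[ℚ] Tens n g ⊗[ℚ] ExteriorAlgebra ℚ g :=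
  polarize (ceSubst n) (ceSpace t m n) isMultilin_ceSubst

@[simp] theorem ceAct_tprod {t m n : ℕ} (z : ceSpace t m n) (X : Fin m → g) :
    ceAct g z (PiTensorProduct.tprod ℚ X) = ceSubst n X z := polarize_tprod _ _ _ _ _

theorem sum_bind {ι α β : Type*} (s : Finset ι) (T : ι → Multiset α) (S : α → Multiset β) :
    ∑ i ∈ s, (T i).bind S = (∑ i ∈ s, T i).bind S := by
  classical
  induction s using Finset.induction_on with
  | empty => simp
  | insert a s ha ih => simp [Finset.sum_insert ha, ih]

theorem ceAct_mem {α : Type} {t m n : ℕ} (z : ceSpace t m n) {A : Multiset α}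
    {y : Tens m (FreeLieAlgebra ℚ α)} (hy : y ∈ tensSpan m A) :
    ceAct (FreeLieAlgebra ℚ α) z y ∈ ceSpan n t A := by
  obtain ⟨z, hz⟩ := z
  induction hy using Submodule.span_induction with
  | zero => simp
  | add y z _ _ hy hz => rw [map_add]; exact add_mem hy hz
  | smul c z _ hz => rw [map_smul]; exact Submodule.smul_mem _ c hz
  | mem y hy =>
    obtain ⟨S, hS, rfl⟩ := hy
    rw [ceAct_tprod]
    induction hz using Submodule.span_induction with
    | zero => simp
    | add y z _ _ hy hz => rw [map_add]; exact add_mem hy hz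
    | smul c z _ hz => rw [map_smul]; exact Submodule.smul_mem _ c hz
    | mem φ hφ =>
      obtain ⟨T, U, hT, rfl⟩ := hφ
      rw [ceSubst_forest]
      refine Submodule.subset_span ⟨fun i => FreeMagma.lift S (T i),
        fun i => FreeMagma.lift S (U i), ?_, by simp [lieWord_lift]⟩
      simp only [leaves_lift, sum_bind]
      rw [← hS, ← Multiset.add_bind, hT]
      simp [Multiset.bind, Multiset.join, Finset.sum]

theorem ceMap_ceAct (f : g →ₗ⁅ℚ⁆ h) {t m n : ℕ} (z : ceSpace t m n) (y : Tens m g) :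
    ceMap n f (ceAct g z y) =
      ceAct h z (PiTensorProduct.map (fun _ => (f : g →ₗ[ℚ] h)) y) := by
  rw [← LinearMap.comp_apply, ← LinearMap.comp_apply]
  congr 1
  refine PiTensorProduct.ext (MultilinearMap.ext fun X => ?_)
  simp only [LinearMap.compMultilinearMap_apply, LinearMap.comp_apply, ceAct_tprod,
    PiTensorProduct.map_tprod]
  simp only [ceSubst, ceMap]
  rw [← LinearMap.comp_apply, ← TensorProduct.map_comp, ← PiTensorProduct.map_comp]
  have this : f.comp (FreeLieAlgebra.lift ℚ X) = FreeLieAlgebra.lift ℚ fun i => f (X i) := by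
    apply FreeLieAlgebra.hom_ext; simp
  have h1 : (f : g →ₗ[ℚ] h) ∘ₗ (FreeLieAlgebra.lift ℚ X : FreeLieAlgebra ℚ (Fin m) →ₗ[ℚ] g) =
      (FreeLieAlgebra.lift ℚ fun i => f (X i) : FreeLieAlgebra ℚ (Fin m) →ₗ[ℚ] h) := by
    rw [← this]; rfl
  have h2 : (ExteriorAlgebra.map (f : g →ₗ[ℚ] h)).toLinearMap ∘ₗ (ExteriorAlgebra.map
      (FreeLieAlgebra.lift ℚ X : FreeLieAlgebra ℚ (Fin m) →ₗ[ℚ] g)).toLinearMap =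
      (ExteriorAlgebra.map (FreeLieAlgebra.lift ℚ fun i => f (X i) :
        FreeLieAlgebra ℚ (Fin m) →ₗ[ℚ] h)).toLinearMap := by
    rw [← AlgHom.comp_toLinearMap, ExteriorAlgebra.map_comp_map, h1]
  rw [h1, h2]
  rfl

end CEBimodule

/-! ### The projection `π` -/

attribute [local instance] LieRing.ofAssociativeRing

section Pi

variable {α β : Type*} {M N : Type*} [AddCommGroup M] [Module ℚ M] [AddCommGroup N] [Module ℚ N]

/-- The inclusion `Lie ↪ Ass^u`: the Lie algebra morphism from the free Lie algebra to the free
associative algebra that is the identity on generators. -/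
def lieToAss (α : Type*) : FreeLieAlgebra ℚ α →ₗ⁅ℚ⁆ FreeAlgebra ℚ α :=
  FreeLieAlgebra.lift ℚ (FreeAlgebra.ι ℚ)

/-- For `M` a right module over the free Lie algebra, the right module structure over the free
associative algebra on `M × (M ⊗ Λ)` given on generators by `(m, w) · x_a = (m · x_a, m ⊗ x_a)`.
Thus `(m, 0) · x_{a_1} ⋯ x_{a_k} = (m · x_{a_1} ⋯ x_{a_k}, (m · x_{a_1} ⋯ x_{a_{k-1}}) ⊗ x_{a_k})`
for `k ≥ 1`. -/
def assAct (ρ : FreeLieAlgebra ℚ α →ₗ[ℚ] Module.End ℚ M) : FreeAlgebra ℚ α →ₐ[ℚ]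
    (Module.End ℚ (M × (M ⊗[ℚ] ExteriorAlgebra ℚ (FreeLieAlgebra ℚ α))))ᵐᵒᵖ :=
  FreeAlgebra.lift ℚ fun a => MulOpposite.op <|
    ((ρ (FreeLieAlgebra.of ℚ a)).prod ((TensorProduct.mk ℚ M _).flip
      (ExteriorAlgebra.ι ℚ (FreeLieAlgebra.of ℚ a)))) ∘ₗ LinearMap.fst ℚ M _

/-- For `X` in the free Lie algebra, the map `m ↦ π(m ⊗ X)`: writing `X = ∑ w · x_a` in the free
associative algebra, `π(m ⊗ X) = ∑ (m · w) ⊗ x_a`. -/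
def foxMap (ρ : FreeLieAlgebra ℚ α →ₗ[ℚ] Module.End ℚ M) : FreeLieAlgebra ℚ α →ₗ[ℚ]
    (M →ₗ[ℚ] M ⊗[ℚ] ExteriorAlgebra ℚ (FreeLieAlgebra ℚ α)) where
  toFun X := LinearMap.snd ℚ M _ ∘ₗ (assAct ρ (lieToAss α X)).unop ∘ₗ LinearMap.inl ℚ M _
  map_add' X Y := by ext m; simp
  map_smul' c X := by ext m; simp

/-- The projection `π`, on `M ⊗ Λ(FreeLie(α))`, extended by zero outside of degree one. -/
def piMap (ρ : FreeLieAlgebra ℚ α →ₗ[ℚ] Module.End ℚ M) :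
    M ⊗[ℚ] ExteriorAlgebra ℚ (FreeLieAlgebra ℚ α) →ₗ[ℚ]
      M ⊗[ℚ] ExteriorAlgebra ℚ (FreeLieAlgebra ℚ α) :=
  TensorProduct.lift (foxMap ρ ∘ₗ ExteriorAlgebra.ιInv).flip

theorem freeLie_induction {P : FreeLieAlgebra ℚ α → Prop} (h0 : P 0)
    (hof : ∀ a, P (FreeLieAlgebra.of ℚ a)) (hadd : ∀ x y, P x → P y → P (x + y))
    (hsmul : ∀ (c : ℚ) x, P x → P (c • x)) (hlie : ∀ x y, P x → P y → P ⁅x, y⁆) (x) : P x := by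
  let S : LieSubalgebra ℚ (FreeLieAlgebra ℚ α) :=
    { carrier := {x | P x}
      add_mem' := fun {x y} hx hy => hadd x y hx hy
      zero_mem' := h0
      smul_mem' := fun c x hx => hsmul c x hx
      lie_mem' := fun {x y} hx hy => hlie x y hx hy }
  have h : S.incl.comp (FreeLieAlgebra.lift ℚ fun a => (⟨FreeLieAlgebra.of ℚ a, hof a⟩ : S)) =
      LieHom.id := by
    apply FreeLieAlgebra.hom_ext
    intro a
    simp
  have h' := LieHom.congr_fun h x
  rw [LieHom.id_apply] at h'
  rw [← h']
  exact (FreeLieAlgebra.lift ℚ (fun a => (⟨FreeLieAlgebra.of ℚ a, hof a⟩ : S)) x).2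

@[simp] theorem foxMap_of (ρ : FreeLieAlgebra ℚ α →ₗ[ℚ] Module.End ℚ M) (a : α) (m : M) :
    foxMap ρ (FreeLieAlgebra.of ℚ a) m = m ⊗ₜ ExteriorAlgebra.ι ℚ (FreeLieAlgebra.of ℚ a) := by
  simp [foxMap, assAct, lieToAss]

@[simp] theorem piMap_tmul (ρ : FreeLieAlgebra ℚ α →ₗ[ℚ] Module.End ℚ M) (m : M) (ω) :
    piMap ρ (m ⊗ₜ ω) = foxMap ρ (ExteriorAlgebra.ιInv ω) m := rfl

theorem assAct_lieToAss (ρ : FreeLieAlgebra ℚ α →ₗ[ℚ] Module.End ℚ M)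
    (hρ : ∀ x y, ρ ⁅x, y⁆ = ρ y * ρ x - ρ x * ρ y) (x) (m : M) (w) :
    (assAct ρ (lieToAss α x)).unop (m, w) = (ρ x m, foxMap ρ x m) := by
  suffices h : ∀ m w, (assAct ρ (lieToAss α x)).unop (m, w) =
      (ρ x m, ((assAct ρ (lieToAss α x)).unop (m, 0)).2) from h m w
  clear m w
  induction x using freeLie_induction with
  | h0 => intro m w; simp; rfl
  | hof a => simp [assAct, lieToAss]
  | hadd x y hx hy => intro m w; simp [hx m w, hy m w]
  | hsmul c x hx => intro m w; simp [hx m w]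
  | hlie x y hx hy =>
    intro m w
    have e : ∀ p, (assAct ρ (lieToAss α ⁅x, y⁆)).unop p =
        (assAct ρ (lieToAss α y)).unop ((assAct ρ (lieToAss α x)).unop p) -
        (assAct ρ (lieToAss α x)).unop ((assAct ρ (lieToAss α y)).unop p) := by
      intro p
      simp [LieRing.of_associative_ring_bracket]
    have ex : ∀ m w, ((assAct ρ (lieToAss α x)).unop (m, w)).2 =
      ((assAct ρ (lieToAss α x)).unop (m, 0)).2 := fun m w => by rw [hx m w]
    have ey : ∀ m w, ((assAct ρ (lieToAss α y)).unop (m, w)).2 =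
      ((assAct ρ (lieToAss α y)).unop (m, 0)).2 := fun m w => by rw [hy m w]
    rw [e, e, hx m w, hy m w, hx m 0, hy m 0, hx (ρ y m), hy (ρ x m), hρ]
    rfl

theorem foxMap_lie (ρ : FreeLieAlgebra ℚ α →ₗ[ℚ] Module.End ℚ M)
    (hρ : ∀ x y, ρ ⁅x, y⁆ = ρ y * ρ x - ρ x * ρ y) (x y) (m : M) :
    foxMap ρ ⁅x, y⁆ m = foxMap ρ y (ρ x m) - foxMap ρ x (ρ y m) := by
  have e : ∀ p, (assAct ρ (lieToAss α ⁅x, y⁆)).unop p =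
      (assAct ρ (lieToAss α y)).unop ((assAct ρ (lieToAss α x)).unop p) -
      (assAct ρ (lieToAss α x)).unop ((assAct ρ (lieToAss α y)).unop p) := by
    intro p
    simp [LieRing.of_associative_ring_bracket]
  have h := assAct_lieToAss ρ hρ ⁅x, y⁆ m 0
  rw [e, assAct_lieToAss ρ hρ x, assAct_lieToAss ρ hρ y, assAct_lieToAss ρ hρ x,
    assAct_lieToAss ρ hρ y] at h
  exact (congrArg Prod.snd h).symm

theorem piMap_ι_mul_ι (ρ : FreeLieAlgebra ℚ α →ₗ[ℚ] Module.End ℚ M)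
    (hρ : ∀ x y, ρ ⁅x, y⁆ = ρ y * ρ x - ρ x * ρ y) (x y) (m : M) :
    piMap ρ (ceD ρ (m ⊗ₜ (ExteriorAlgebra.ι ℚ x * ExteriorAlgebra.ι ℚ y))) = 0 := by
  have h : ∀ z, ExteriorAlgebra.ιInv (ExteriorAlgebra.ι ℚ z) = z :=
    ExteriorAlgebra.ι_leftInverse (R := ℚ) (M := FreeLieAlgebra ℚ α)
  simp [ceD_ι_mul_ι, h, foxMap_lie ρ hρ]

theorem ceD_foxMap (ρ : FreeLieAlgebra ℚ α →ₗ[ℚ] Module.End ℚ M)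
    (hρ : ∀ x y, ρ ⁅x, y⁆ = ρ y * ρ x - ρ x * ρ y) (x) (m : M) :
    ceD ρ (foxMap ρ x m) = ρ x m ⊗ₜ 1 := by
  induction x using freeLie_induction generalizing m with
  | h0 => simp
  | hof a => simp [ceD_ι]
  | hadd x y hx hy => simp [hx m, hy m, add_tmul]
  | hsmul c x hx => simp [hx m, smul_tmul']
  | hlie x y hx hy => simp [foxMap_lie ρ hρ, hx, hy, hρ, sub_tmul]

/-- Naturality of `π` with respect to endomorphisms of the module. -/
theorem foxMap_rTensor (ρ : FreeLieAlgebra ℚ α →ₗ[ℚ] Module.End ℚ M)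
    (hρ : ∀ x y, ρ ⁅x, y⁆ = ρ y * ρ x - ρ x * ρ y)
    (σ : FreeLieAlgebra ℚ α →ₗ[ℚ] Module.End ℚ N)
    (hσ : ∀ x y, σ ⁅x, y⁆ = σ y * σ x - σ x * σ y) (F : M →ₗ[ℚ] N)
    (hF : ∀ x m, F (ρ x m) = σ x (F m)) (x) (m : M) :
    LinearMap.rTensor _ F (foxMap ρ x m) = foxMap σ x (F m) := by
  induction x using freeLie_induction generalizing m with
  | h0 => simp
  | hof a => simp
  | hadd x y hx hy => simp [hx m, hy m]
  | hsmul c x hx => simp [hx m]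
  | hlie x y hx hy => simp [foxMap_lie ρ hρ, foxMap_lie σ hσ, hx, hy, hF]

/-- Naturality of `π` with respect to Lie algebra morphisms, which holds after projection. -/
theorem piMap_map_foxMap (ρ : FreeLieAlgebra ℚ α →ₗ[ℚ] Module.End ℚ M)
    (hρ : ∀ x y, ρ ⁅x, y⁆ = ρ y * ρ x - ρ x * ρ y)
    (σ : FreeLieAlgebra ℚ β →ₗ[ℚ] Module.End ℚ N)
    (hσ : ∀ x y, σ ⁅x, y⁆ = σ y * σ x - σ x * σ y)
    (f : FreeLieAlgebra ℚ α →ₗ⁅ℚ⁆ FreeLieAlgebra ℚ β) (F : M →ₗ[ℚ] N)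
    (hF : ∀ x m, F (ρ x m) = σ (f x) (F m)) (x) (m : M) :
    piMap σ (TensorProduct.map F (ExteriorAlgebra.map (f : FreeLieAlgebra ℚ α →ₗ[ℚ]
      FreeLieAlgebra ℚ β)).toLinearMap (foxMap ρ x m)) = foxMap σ (f x) (F m) := by
  have h : ∀ z, ExteriorAlgebra.ιInv (ExteriorAlgebra.ι ℚ z) = z :=
    ExteriorAlgebra.ι_leftInverse (R := ℚ) (M := FreeLieAlgebra ℚ β)
  induction x using freeLie_induction generalizing m with
  | h0 => simp
  | hof a => simp [h]
  | hadd x y hx hy => simp [hx m, hy m]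
  | hsmul c x hx => simp [hx m]
  | hlie x y hx hy => simp [foxMap_lie ρ hρ, foxMap_lie σ hσ, hx, hy, hF]

theorem piMap_map_piMap (ρ : FreeLieAlgebra ℚ α →ₗ[ℚ] Module.End ℚ M)
    (hρ : ∀ x y, ρ ⁅x, y⁆ = ρ y * ρ x - ρ x * ρ y)
    (σ : FreeLieAlgebra ℚ β →ₗ[ℚ] Module.End ℚ N)
    (hσ : ∀ x y, σ ⁅x, y⁆ = σ y * σ x - σ x * σ y)
    (f : FreeLieAlgebra ℚ α →ₗ⁅ℚ⁆ FreeLieAlgebra ℚ β) (F : M →ₗ[ℚ] N)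
    (hF : ∀ x m, F (ρ x m) = σ (f x) (F m)) (z) :
    piMap σ (TensorProduct.map F (ExteriorAlgebra.map (f : FreeLieAlgebra ℚ α →ₗ[ℚ]
      FreeLieAlgebra ℚ β)).toLinearMap (piMap ρ z)) =
    piMap σ (TensorProduct.map F (ExteriorAlgebra.map (f : FreeLieAlgebra ℚ α →ₗ[ℚ]
      FreeLieAlgebra ℚ β)).toLinearMap z) := by
  induction z with
  | zero => simp
  | add a b ha hb => simp only [map_add, ha, hb]
  | tmul m ω =>
    have h := LinearMap.congr_fun (ExteriorAlgebra.ιInv_comp_map (f : FreeLieAlgebra ℚ α →ₗ[ℚ]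
      FreeLieAlgebra ℚ β)) ω
    simp only [LinearMap.comp_apply, AlgHom.toLinearMap_apply] at h
    rw [piMap_tmul, piMap_map_foxMap ρ hρ σ hσ f F hF, TensorProduct.map_tmul, piMap_tmul,
      AlgHom.toLinearMap_apply, h]
    rfl

end Pi

section DeltaOne

variable {α : Type}

/-- The multigraded part of `FreeLie(α)^{⊗ n} ⊗ V ⊆ FreeLie(α)^{⊗ n} ⊗ Λ(FreeLie(α))`, of
multidegree `A`, where `V` is the vector space of generators. -/
def deltaSpan (n : ℕ) (A : Multiset α) :
    Submodule ℚ (Tens n (FreeLieAlgebra ℚ α) ⊗[ℚ] ExteriorAlgebra ℚ (FreeLieAlgebra ℚ α)) :=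
  Submodule.span ℚ {z | ∃ (T : Fin n → FreeMagma α) (a : α),
    ∑ i, leaves (T i) + {a} = A ∧
    PiTensorProduct.tprod ℚ (fun i => lieWord (FreeLieAlgebra.of ℚ) (T i)) ⊗ₜ
      ExteriorAlgebra.ι ℚ (FreeLieAlgebra.of ℚ a) = z}

/-- The projection `π` with coefficients in `FreeLie(α)^{⊗ n}`. -/
abbrev proj (α : Type*) (n : ℕ) := piMap (adAct (FreeLieAlgebra ℚ α) n)

theorem deltaSpan_le (n : ℕ) (A : Multiset α) : deltaSpan n A ≤ ceSpan n 1 A := by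
  refine Submodule.span_mono ?_
  rintro z ⟨T, a, rfl, rfl⟩
  exact ⟨T, fun _ => FreeMagma.of a, by simp, by simp [ExteriorAlgebra.ιMulti_succ_apply]⟩

theorem tmul_mem_deltaSpan {n : ℕ} {A : Multiset α} (a : α) {y} (hy : y ∈ tensSpan n A) :
    y ⊗ₜ ExteriorAlgebra.ι ℚ (FreeLieAlgebra.of ℚ a) ∈ deltaSpan n (A + {a}) := by
  induction hy using Submodule.span_induction with
  | zero => simp
  | add y z _ _ hy hz => rw [add_tmul]; exact add_mem hy hz
  | smul c z _ hz => rw [← smul_tmul']; exact Submodule.smul_mem _ c hz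
  | mem z hz =>
    obtain ⟨T, rfl, rfl⟩ := hz
    exact Submodule.subset_span ⟨T, a, rfl, rfl⟩

theorem foxMap_mem {n : ℕ} {A : Multiset α} (U : FreeMagma α) {y} (hy : y ∈ tensSpan n A) :
    foxMap (adAct _ n) (lieWord (FreeLieAlgebra.of ℚ) U) y ∈ deltaSpan n (A + leaves U) := by
  induction U generalizing A y with
  | ih1 a => simpa using tmul_mem_deltaSpan a hy
  | ih2 s t hs ht =>
    rw [lieWord_mul, foxMap_lie _ adAct_lie, leaves_mul]
    refine sub_mem ?_ ?_
    · rw [← add_assoc]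
      exact ht (adAct_mem s hy)
    · rw [add_comm (leaves s), ← add_assoc]
      exact hs (adAct_mem t hy)

theorem proj_mem {n : ℕ} {A : Multiset α} {z} (hz : z ∈ ceSpan n 1 A) :
    proj α n z ∈ deltaSpan n A := by
  have h : ∀ z : FreeLieAlgebra ℚ α, ExteriorAlgebra.ιInv (ExteriorAlgebra.ι ℚ z) = z :=
    ExteriorAlgebra.ι_leftInverse (R := ℚ) (M := FreeLieAlgebra ℚ α)
  refine ceSpan_succ_induction (P := fun z => proj α n z ∈ deltaSpan n A)
    (by simp) (fun x y hx hy => ?_) (fun c x hx => ?_) (fun V B w hB hw => ?_) hz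
  · rw [map_add]; exact add_mem hx hy
  · rw [map_smul]; exact Submodule.smul_mem _ c hx
  · subst hB
    refine ceSpan_zero_induction (P := fun w => proj α n (wedge _ (lieWord (FreeLieAlgebra.of ℚ) V)
      w) ∈ deltaSpan n (B + leaves V)) (fun y hy => ?_) hw
    simpa [h] using foxMap_mem V hy

/-- `π` is a retraction onto `δ^{(1)}`. -/
theorem proj_deltaSpan {n : ℕ} {A : Multiset α} {z} (hz : z ∈ deltaSpan n A) :
    proj α n z = z := by
  have h : ∀ z : FreeLieAlgebra ℚ α, ExteriorAlgebra.ιInv (ExteriorAlgebra.ι ℚ z) = z :=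
    ExteriorAlgebra.ι_leftInverse (R := ℚ) (M := FreeLieAlgebra ℚ α)
  induction hz using Submodule.span_induction with
  | zero => simp
  | add y z _ _ hy hz => rw [map_add, hy, hz]
  | smul c z _ hz => rw [map_smul, hz]
  | mem z hz =>
    obtain ⟨T, a, rfl, rfl⟩ := hz
    simp [h]

theorem ceD_proj {n : ℕ} {A : Multiset α} {z} (hz : z ∈ ceSpan n 1 A) :
    ceD (adAct _ n) (proj α n z) = ceD (adAct _ n) z := by
  have h : ∀ z : FreeLieAlgebra ℚ α, ExteriorAlgebra.ιInv (ExteriorAlgebra.ι ℚ z) = z :=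
    ExteriorAlgebra.ι_leftInverse (R := ℚ) (M := FreeLieAlgebra ℚ α)
  refine ceSpan_succ_induction (P := fun z => ceD (adAct _ n) (proj α n z) = ceD (adAct _ n) z)
    (by simp) (fun x y hx hy => ?_) (fun c x hx => ?_) (fun V B w hB hw => ?_) hz
  · simp only [map_add, hx, hy]
  · simp only [map_smul, hx]
  · refine ceSpan_zero_induction (P := fun w => ceD (adAct _ n) (proj α n (wedge _
      (lieWord (FreeLieAlgebra.of ℚ) V) w)) = ceD (adAct _ n) (wedge _
      (lieWord (FreeLieAlgebra.of ℚ) V) w)) (fun y hy => ?_) hw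
    simp [h, ceD_foxMap _ adAct_lie, ceD_ι]

theorem proj_ceD {n : ℕ} {A : Multiset α} {z} (hz : z ∈ ceSpan n 2 A) :
    proj α n (ceD (adAct _ n) z) = 0 := by
  refine ceSpan_succ_induction (P := fun z => proj α n (ceD (adAct _ n) z) = 0)
    (by simp) (fun x y hx hy => ?_) (fun c x hx => ?_) (fun V B w hB hw => ?_) hz
  · simp only [map_add, hx, hy, add_zero]
  · simp only [map_smul, hx, smul_zero]
  · refine ceSpan_succ_induction (P := fun w => proj α n (ceD (adAct _ n) (wedge _
      (lieWord (FreeLieAlgebra.of ℚ) V) w)) = 0)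
      (by simp) (fun x y hx hy => ?_) (fun c x hx => ?_) (fun U C v hC hv => ?_) hw
    · simp only [map_add, hx, hy, add_zero]
    · simp only [map_smul, hx, smul_zero]
    · refine ceSpan_zero_induction (P := fun v => proj α n (ceD (adAct _ n) (wedge _
        (lieWord (FreeLieAlgebra.of ℚ) V) (wedge _ (lieWord (FreeLieAlgebra.of ℚ) U) v))) = 0)
        (fun y hy => ?_) hv
      simpa using piMap_ι_mul_ι (adAct _ n) adAct_lie _ _ y

end DeltaOne

/-! ### The category `CatLie`, its modules and its bimodules -/

/-- The `ℚ`-linear category `CatLie` associated to the Lie operad, with set of objects `ℕ`. -/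
structure CatLie : Type where
  /-- The natural number underlying an object. -/
  arity : ℕ

theorem lift_of (m : ℕ) : FreeLieAlgebra.lift ℚ (FreeLieAlgebra.of ℚ) =
    (LieHom.id : FreeLieAlgebra ℚ (Fin m) →ₗ⁅ℚ⁆ FreeLieAlgebra ℚ (Fin m)) := by
  apply FreeLieAlgebra.hom_ext; simp

theorem homComp_homId {m n : ℕ} (φ : homSpace m n) : homComp φ (homId m) = φ := by
  refine Subtype.ext ?_
  simp only [homComp, homId, act_tprod, tensSubst, lift_of]
  exact LinearMap.congr_fun PiTensorProduct.map_id φ.1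

instance : Category.{0} CatLie where
  Hom m n := homSpace m.arity n.arity
  id n := homId n.arity
  comp φ ψ := homComp ψ φ
  id_comp φ := homComp_homId φ
  comp_id φ := Subtype.ext <| by simp only [homComp, act_homId, LinearMap.id_apply]
  assoc φ ψ χ := Subtype.ext (LinearMap.congr_fun (act_comp χ ψ) φ.1).symm

instance (m n : CatLie) : AddCommGroup (m ⟶ n) :=
  inferInstanceAs (AddCommGroup (homSpace m.arity n.arity))

instance (m n : CatLie) : Module ℚ (m ⟶ n) :=
  inferInstanceAs (Module ℚ (homSpace m.arity n.arity))

instance : Preadditive CatLie where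
  homGroup _ _ := inferInstance
  add_comp _ _ _ φ φ' ψ := Subtype.ext (map_add (act _ ψ) φ.1 φ'.1)
  comp_add X _ _ φ ψ ψ' := Subtype.ext <|
    LinearMap.congr_fun (map_add (act (FreeLieAlgebra ℚ (Fin X.arity))) ψ ψ') φ.1

instance : Linear ℚ CatLie where
  homModule _ _ := inferInstance
  smul_comp _ _ _ c φ ψ := Subtype.ext (map_smul (act _ ψ) c φ.1)
  comp_smul X _ _ φ c ψ := Subtype.ext <|
    LinearMap.congr_fun (map_smul (act (FreeLieAlgebra ℚ (Fin X.arity))) c ψ) φ.1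

/-- Left `CatLie`-modules: `ℚ`-linear functors from `CatLie` to `ℚ`-vector spaces.
(An additive functor between `ℚ`-linear categories is `ℚ`-linear.) -/
abbrev LeftMod : Type (u + 1) := CatLie ⥤+ ModuleCat.{u} ℚ

/-- `CatLie`-bimodules `B`, contravariant in the first variable: the vector space `B(m, n)` is
`(B.obj.obj (op m)).obj.obj n`. -/
abbrev Bimod : Type 1 := CatLieᵒᵖ ⥤+ LeftMod.{0}

section Bimodules

open Opposite

theorem rTensor_act_mem {α : Type} {n p t : ℕ} (χ : homSpace n p) {A : Multiset α} {z}
    (hz : z ∈ ceSpan n t A) :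
    LinearMap.rTensor (ExteriorAlgebra ℚ (FreeLieAlgebra ℚ α)) (act (FreeLieAlgebra ℚ α) χ) z ∈
      ceSpan p t A := by
  induction hz using Submodule.span_induction with
  | zero => simp
  | add y z _ _ hy hz => rw [map_add]; exact add_mem hy hz
  | smul c z _ hz => rw [map_smul]; exact Submodule.smul_mem _ c hz
  | mem z hz =>
    obtain ⟨T, U, rfl, rfl⟩ := hz
    rw [LinearMap.rTensor_tmul]
    have h := act_mem χ (A := ∑ i, leaves (T i)) (Submodule.subset_span ⟨T, rfl, rfl⟩)
    generalize act (FreeLieAlgebra ℚ α) χ _ = y at h ⊢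
    induction h using Submodule.span_induction with
    | zero => simp
    | add y z _ _ hy hz => rw [add_tmul]; exact add_mem hy hz
    | smul c z _ hz => rw [← smul_tmul']; exact Submodule.smul_mem _ c hz
    | mem z hz =>
      obtain ⟨S, hS, rfl⟩ := hz
      exact Submodule.subset_span ⟨S, U, by rw [hS], rfl⟩

theorem rTensor_act_mem_delta {α : Type} {n p : ℕ} (χ : homSpace n p) {A : Multiset α} {z}
    (hz : z ∈ deltaSpan n A) :
    LinearMap.rTensor (ExteriorAlgebra ℚ (FreeLieAlgebra ℚ α)) (act (FreeLieAlgebra ℚ α) χ) z ∈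
      deltaSpan p A := by
  induction hz using Submodule.span_induction with
  | zero => simp
  | add y z _ _ hy hz => rw [map_add]; exact add_mem hy hz
  | smul c z _ hz => rw [map_smul]; exact Submodule.smul_mem _ c hz
  | mem z hz =>
    obtain ⟨T, a, rfl, rfl⟩ := hz
    rw [LinearMap.rTensor_tmul]
    exact tmul_mem_deltaSpan a (act_mem χ (Submodule.subset_span ⟨T, rfl, rfl⟩))

variable {g h : Type*} [LieRing g] [LieAlgebra ℚ g] [LieRing h] [LieAlgebra ℚ h]

theorem ceAct_comp {t k m n : ℕ} (z : ceSpace t m n) (φ : homSpace k m) :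
    ceAct g ⟨ceAct _ z φ, ceAct_mem z φ.2⟩ = ceAct g z ∘ₗ act g φ := by
  refine PiTensorProduct.ext (MultilinearMap.ext fun X => ?_)
  simp only [LinearMap.compMultilinearMap_apply, LinearMap.comp_apply, ceAct_tprod, act_tprod]
  exact ceMap_ceAct (FreeLieAlgebra.lift ℚ X) z φ

theorem ceAct_id {t m n : ℕ} (z : ceSpace t m n) : ceAct _ z (homId m).1 = z.1 := by
  have h : FreeLieAlgebra.lift ℚ (FreeLieAlgebra.of ℚ) = (LieHom.id :
      FreeLieAlgebra ℚ (Fin m) →ₗ⁅ℚ⁆ _) := by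
    apply FreeLieAlgebra.hom_ext; simp
  simp only [homId, ceAct_tprod, ceSubst, ceMap, h]
  have h1 : ((LieHom.id : FreeLieAlgebra ℚ (Fin m) →ₗ⁅ℚ⁆ _) :
    FreeLieAlgebra ℚ (Fin m) →ₗ[ℚ] FreeLieAlgebra ℚ (Fin m)) = LinearMap.id := rfl
  rw [h1, PiTensorProduct.map_id, ExteriorAlgebra.map_id]
  exact LinearMap.congr_fun TensorProduct.map_id z.1

/-- The left and right actions on `CE_t` commute. -/
theorem ceAct_rTensor {t m n p : ℕ} (χ : homSpace n p) (z : ceSpace t m n) (y : Tens m g) :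
    ceAct g ⟨LinearMap.rTensor _ (act _ χ) z.1, rTensor_act_mem χ z.2⟩ y =
      LinearMap.rTensor _ (act g χ) (ceAct g z y) := by
  rw [← LinearMap.comp_apply]
  congr 1
  refine PiTensorProduct.ext (MultilinearMap.ext fun X => ?_)
  simp only [LinearMap.compMultilinearMap_apply, LinearMap.comp_apply, ceAct_tprod, ceSubst, ceMap]
  generalize z.1 = w
  induction w with
  | zero => simp
  | add a b ha hb => simp only [map_add, ha, hb]
  | tmul a ω => simp [map_act]

theorem ceD_rTensor {n p : ℕ} (χ : homSpace n p) (z : Tens n g ⊗[ℚ] ExteriorAlgebra ℚ g) :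
    ceD (adAct g p) (LinearMap.rTensor _ (act g χ) z) =
      LinearMap.rTensor _ (act g χ) (ceD (adAct g n) z) := by
  have h := ceD_map (adAct g n) (adAct g p) (LieHom.id : g →ₗ⁅ℚ⁆ g) (act g χ)
    (fun x m => act_adAct χ x m) z
  have h1 : ((LieHom.id : g →ₗ⁅ℚ⁆ g) : g →ₗ[ℚ] g) = LinearMap.id := rfl
  rw [h1, ExteriorAlgebra.map_id] at h
  exact h.symm

theorem ceD_ceAct {t m n : ℕ} (z : ceSpace (t + 1) m n) (y : Tens m g) :
    ceAct g (⟨ceD (adAct _ n) z.1, ceD_mem z.2⟩ : ceSpace t m n) y =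
      ceD (adAct g n) (ceAct g z y) := by
  rw [← LinearMap.comp_apply]
  congr 1
  refine PiTensorProduct.ext (MultilinearMap.ext fun X => ?_)
  simp only [LinearMap.compMultilinearMap_apply, LinearMap.comp_apply, ceAct_tprod, ceSubst,
    ceD_ceMap]

/-- The left `CatLie`-module `n ↦ CE_t(m, n)`. -/
def ceLeft (t m : ℕ) : LeftMod.{0} :=
  ⟨{ obj := fun n => ModuleCat.of ℚ (ceSpace t m n.arity)
     map := fun χ => ModuleCat.ofHom
       ((LinearMap.rTensor _ (act (FreeLieAlgebra ℚ (Fin m)) χ)).restrict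
         fun _ hz => rTensor_act_mem χ hz)
     map_id := fun n => by
       ext z
       exact ((congrArg (fun F => LinearMap.rTensor _ F z.1) (act_homId n.arity)).trans
         (LinearMap.congr_fun (LinearMap.rTensor_id _ _) z.1))
     map_comp := fun χ ψ => by
       ext z
       exact ((congrArg (fun F => LinearMap.rTensor _ F z.1) (act_comp ψ χ)).trans
         (LinearMap.congr_fun (LinearMap.rTensor_comp _ _ _) z.1)) },
   ⟨fun {_ _ χ ψ} => by
      ext z
      exact ((congrArg (fun F => LinearMap.rTensor _ F z.1)
        (map_add (act _) χ ψ)).trans (LinearMap.congr_fun (LinearMap.rTensor_add _ _ _) z.1))⟩⟩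

/-- The bimodule `CE_t = CatLie ⊙ Λ^t Lie`. -/
def ceBimod (t : ℕ) : Bimod :=
  ⟨{ obj := fun m => ceLeft t m.unop.arity
     map := fun {m k} φ => ObjectProperty.homMk
       { app := fun n => ModuleCat.ofHom
           { toFun := fun z : ceSpace t m.unop.arity n.arity =>
               (⟨ceAct _ z φ.unop.1, ceAct_mem z φ.unop.2⟩ : ceSpace t k.unop.arity n.arity)
             map_add' := fun y z => Subtype.ext (by simp)
             map_smul' := fun c z => Subtype.ext (by simp) }
         naturality := fun n p χ => by
           ext z
           refine Subtype.ext ?_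
           exact (ceAct_rTensor χ z _) }
     map_id := fun m => by
       apply ObjectProperty.hom_ext
       ext n z
       refine Subtype.ext ?_
       exact (ceAct_id z)
     map_comp := fun φ ψ => by
       apply ObjectProperty.hom_ext
       ext n z
       refine Subtype.ext ?_
       exact (LinearMap.congr_fun (ceAct_comp z φ.unop) _).symm },
   ⟨fun {_ _ φ ψ} => by
      apply ObjectProperty.hom_ext
      ext n z
      refine Subtype.ext ?_
      exact (map_add (ceAct _ z) φ.unop.1 ψ.unop.1)⟩⟩

/-- The differential `CE_{t+1} → CE_t`. -/
def ceDiff (t : ℕ) : ceBimod (t + 1) ⟶ ceBimod t :=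
  ObjectProperty.homMk
    { app := fun m => ObjectProperty.homMk
        { app := fun n => ModuleCat.ofHom ((ceD (adAct (FreeLieAlgebra ℚ (Fin m.unop.arity))
            n.arity)).restrict fun _ hz => ceD_mem hz :
              ceSpace (t + 1) m.unop.arity n.arity →ₗ[ℚ] ceSpace t m.unop.arity n.arity)
          naturality := fun n p χ => by
            ext z
            refine Subtype.ext ?_
            exact (ceD_rTensor χ z.1) }
      naturality := fun m k φ => by
        apply ObjectProperty.hom_ext
        ext n z
        refine Subtype.ext ?_
        exact (ceD_ceAct z _).symm }

/-- The universal Chevalley–Eilenberg complex `CE_Lie`, a complex of `CatLie`-bimodules. -/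
def ceComplex : ChainComplex Bimod ℕ :=
  ChainComplex.of ceBimod ceDiff fun t => by
    apply ObjectProperty.hom_ext
    ext m : 2
    apply ObjectProperty.hom_ext
    ext n z
    refine Subtype.ext ?_
    exact (ceD_ceD _ adAct_lie _)

/-! ### The complex `ℂLie` -/

/-- `CatLie` as a bimodule over itself. -/
def catLieBimod : Bimod :=
  ⟨{ obj := fun m => ⟨(linearCoyoneda ℚ CatLie).obj m, linearCoyoneda_obj_additive ℚ CatLie m⟩
     map := fun φ => ObjectProperty.homMk ((linearCoyoneda ℚ CatLie).map φ)
     map_id := fun m => by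
       apply ObjectProperty.hom_ext
       exact (linearCoyoneda ℚ CatLie).map_id m
     map_comp := fun φ ψ => by
       apply ObjectProperty.hom_ext
       exact (linearCoyoneda ℚ CatLie).map_comp φ ψ },
   ⟨fun {_ _ φ ψ} => by
      apply ObjectProperty.hom_ext
      ext n z
      exact Preadditive.add_comp _ _ _ φ.unop ψ.unop z⟩⟩

/-- `δ^{(1)}CatLie(m, n) = (CatLie(-, n) ⊙ I)(m)`, the subspace of
`CE_1(m, n) = δCatLie(m, n) = (CatLie(-, n) ⊙ Lie)(m)` spanned by the `Z ⊗ x_a`, with `x_a` one of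
the generators. -/
abbrev deltaSpace (m n : ℕ) := deltaSpan n (Finset.univ.val : Multiset (Fin m))

/-- The inclusion of `δ^{(1)}CatLie` in `CE_1`. -/
abbrev deltaIncl {m n : ℕ} : deltaSpace m n →ₗ[ℚ] ceSpace 1 m n :=
  Submodule.inclusion (deltaSpan_le _ _)

/-- The right action of `φ` in `CatLie(k, m)` on `δ^{(1)}CatLie(m, n)`, `z ↦ π(z · φ)`. -/
def deltaRight {k m n : ℕ} (φ : homSpace k m) : deltaSpace m n →ₗ[ℚ] deltaSpace k n where
  toFun z := ⟨proj _ n (ceAct _ (deltaIncl z) φ.1), proj_mem (ceAct_mem _ φ.2)⟩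
  map_add' y z := Subtype.ext (by simp)
  map_smul' c z := Subtype.ext (by simp)

theorem proj_rTensor {α : Type} {n p : ℕ} (χ : homSpace n p)
    (z : Tens n (FreeLieAlgebra ℚ α) ⊗[ℚ] ExteriorAlgebra ℚ (FreeLieAlgebra ℚ α)) :
    proj α p (LinearMap.rTensor (ExteriorAlgebra ℚ (FreeLieAlgebra ℚ α)) (act _ χ) z) =
      LinearMap.rTensor (ExteriorAlgebra ℚ (FreeLieAlgebra ℚ α)) (act _ χ) (proj α n z) := by
  induction z with
  | zero => simp
  | add a b ha hb => simp only [map_add, ha, hb]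
  | tmul a ω =>
    have h (x : FreeLieAlgebra ℚ α) := foxMap_rTensor (adAct _ n) adAct_lie (adAct _ p) adAct_lie
      (act (FreeLieAlgebra ℚ α) χ) (fun x m => act_adAct χ x m) x a
    simp [proj, piMap, h]

/-- `π` is compatible with the right actions. -/
theorem proj_ceAct {k m n : ℕ} (z : ceSpace 1 m n) (y : Tens m (FreeLieAlgebra ℚ (Fin k))) :
    proj _ n (ceAct _ (deltaIncl ⟨proj _ n z.1, proj_mem z.2⟩) y) = proj _ n (ceAct _ z y) := by
  have h : proj (Fin k) n ∘ₗ ceAct _ (deltaIncl ⟨proj _ n z.1, proj_mem z.2⟩) =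
      proj (Fin k) n ∘ₗ ceAct _ z := by
    refine PiTensorProduct.ext (MultilinearMap.ext fun X => ?_)
    simp only [LinearMap.compMultilinearMap_apply, LinearMap.comp_apply, ceAct_tprod, ceSubst]
    exact piMap_map_piMap (adAct _ n) adAct_lie (adAct _ n) adAct_lie (FreeLieAlgebra.lift ℚ X) _
      (map_adAct _) z.1
  exact LinearMap.congr_fun h y

/-- The left `CatLie`-module `n ↦ δ^{(1)}CatLie(m, n)`. -/
def deltaLeft (m : ℕ) : LeftMod.{0} :=
  ⟨{ obj := fun n => ModuleCat.of ℚ (deltaSpace m n.arity)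
     map := fun χ => ModuleCat.ofHom
       ((LinearMap.rTensor _ (act (FreeLieAlgebra ℚ (Fin m)) χ)).restrict
         fun _ hz => rTensor_act_mem_delta χ hz)
     map_id := fun n => by
       ext z
       exact ((congrArg (fun F => LinearMap.rTensor _ F z.1) (act_homId n.arity)).trans
         (LinearMap.congr_fun (LinearMap.rTensor_id _ _) z.1))
     map_comp := fun χ ψ => by
       ext z
       exact ((congrArg (fun F => LinearMap.rTensor _ F z.1) (act_comp ψ χ)).trans
         (LinearMap.congr_fun (LinearMap.rTensor_comp _ _ _) z.1)) },
   ⟨fun {_ _ χ ψ} => by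
      ext z
      exact ((congrArg (fun F => LinearMap.rTensor _ F z.1)
        (map_add (act _) χ ψ)).trans (LinearMap.congr_fun (LinearMap.rTensor_add _ _ _) z.1))⟩⟩

/-- The bimodule `δ^{(1)}CatLie`, whose bimodule structure is the one for which
`π : δCatLie → δ^{(1)}CatLie` is a morphism of bimodules. -/
def deltaBimod : Bimod :=
  ⟨{ obj := fun m => deltaLeft m.unop.arity
     map := fun {m k} φ => ObjectProperty.homMk
       { app := fun n => ModuleCat.ofHom (deltaRight φ.unop :
           deltaSpace m.unop.arity n.arity →ₗ[ℚ] deltaSpace k.unop.arity n.arity)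
         naturality := fun n p χ => by
           ext z
           refine Subtype.ext ?_
           exact ((congrArg (proj _ _) (ceAct_rTensor χ (deltaIncl z) _)).trans
             (proj_rTensor χ _)) }
     map_id := fun m => by
       apply ObjectProperty.hom_ext
       ext n z
       refine Subtype.ext ?_
       exact ((congrArg (proj _ _) (ceAct_id (deltaIncl z))).trans (proj_deltaSpan z.2))
     map_comp := fun φ ψ => by
       apply ObjectProperty.hom_ext
       ext n z
       refine Subtype.ext ?_
       exact ((congrArg (proj _ _) (LinearMap.congr_fun
         (ceAct_comp (deltaIncl z) φ.unop) _).symm).trans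
           (proj_ceAct ⟨ceAct _ (deltaIncl z) φ.unop.1, ceAct_mem _ φ.unop.2⟩ _).symm) },
   ⟨fun {_ _ φ ψ} => by
      apply ObjectProperty.hom_ext
      ext n z
      refine Subtype.ext ?_
      exact ((congrArg (proj _ _) (map_add (ceAct _ (deltaIncl z))
        φ.unop.1 ψ.unop.1)).trans (map_add _ _ _))⟩⟩

/-- `FreeLie(α)^{⊗ n} ⊗ Λ(FreeLie(α)) → FreeLie(α)^{⊗ n}`, the projection on exterior degree
zero. -/
def degZero (g : Type*) [LieRing g] [LieAlgebra ℚ g] (n : ℕ) :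
    Tens n g ⊗[ℚ] ExteriorAlgebra ℚ g →ₗ[ℚ] Tens n g :=
  (TensorProduct.rid ℚ _).toLinearMap ∘ₗ
    LinearMap.lTensor _ (ExteriorAlgebra.algebraMapInv (R := ℚ) (M := g)).toLinearMap

theorem degZero_mem {α : Type} {n : ℕ} {A : Multiset α} {z} (hz : z ∈ ceSpan n 0 A) :
    degZero (FreeLieAlgebra ℚ α) n z ∈ tensSpan n A :=
  ceSpan_zero_induction (P := fun z => degZero (FreeLieAlgebra ℚ α) n z ∈ tensSpan n A)
    (fun y hy => by simpa [degZero] using hy) hz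

theorem degZero_rTensor {n p : ℕ} (χ : homSpace n p)
    (z : Tens n g ⊗[ℚ] ExteriorAlgebra ℚ g) :
    degZero g p (LinearMap.rTensor _ (act g χ) z) = act g χ (degZero g n z) := by
  induction z with
  | zero => simp
  | add a b ha hb => simp only [map_add, ha, hb]
  | tmul a ω => simp [degZero]

theorem degZero_ceAct {m n : ℕ} (z : ceSpace 0 m n) (y : Tens m g) :
    degZero g n (ceAct g z y) = act g (⟨degZero _ n z.1, degZero_mem z.2⟩ : homSpace m n) y := by
  rw [← LinearMap.comp_apply]
  congr 1
  refine PiTensorProduct.ext (MultilinearMap.ext fun X => ?_)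
  simp only [LinearMap.compMultilinearMap_apply, LinearMap.comp_apply, ceAct_tprod, act_tprod]
  refine ceSpan_zero_induction (P := fun w => degZero g n (ceSubst n X w) =
    tensSubst n X (degZero _ n w)) (fun y _ => ?_) z.2
  simp [degZero, ceSubst, ceMap, tensSubst]

/-- The identification of `CE_0` with `CatLie`, `Z ⊗ 1 ↦ Z`. -/
def ceZero : ceBimod 0 ⟶ catLieBimod :=
  ObjectProperty.homMk
    { app := fun m => ObjectProperty.homMk
        { app := fun n => ModuleCat.ofHom ((degZero (FreeLieAlgebra ℚ (Fin m.unop.arity))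
            n.arity).restrict fun _ hz => degZero_mem hz :
              ceSpace 0 m.unop.arity n.arity →ₗ[ℚ] homSpace m.unop.arity n.arity)
          naturality := fun n p χ => by
            ext z
            refine Subtype.ext ?_
            exact (degZero_rTensor χ z.1) }
      naturality := fun m k φ => by
        apply ObjectProperty.hom_ext
        ext n z
        refine Subtype.ext ?_
        exact (degZero_ceAct z _) }

/-- The morphism of bimodules `π : CE_1 = δCatLie → δ^{(1)}CatLie`. -/
def projBimod : ceBimod 1 ⟶ deltaBimod :=
  ObjectProperty.homMk
    { app := fun m => ObjectProperty.homMk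
        { app := fun n => ModuleCat.ofHom ((proj (Fin m.unop.arity) n.arity).restrict
            fun _ hz => proj_mem hz :
              ceSpace 1 m.unop.arity n.arity →ₗ[ℚ] deltaSpace m.unop.arity n.arity)
          naturality := fun n p χ => by
            ext z
            refine Subtype.ext ?_
            exact (proj_rTensor χ z.1) }
      naturality := fun m k φ => by
        apply ObjectProperty.hom_ext
        ext n z
        refine Subtype.ext ?_
        exact (proj_ceAct z _).symm }

/-- The map `Z ⊗ x ↦ Z · x` from `δ^{(1)}CatLie(m, n)` to `CatLie(m, n)`: the restriction of the
Chevalley–Eilenberg differential `CE_1 → CE_0 = CatLie`. -/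
def muLin (m n : ℕ) : deltaSpace m n →ₗ[ℚ] homSpace m n :=
  (degZero _ n ∘ₗ ceD (adAct _ n)).restrict fun _ hz => degZero_mem (ceD_mem (deltaSpan_le _ _ hz))

theorem muLin_proj {m n : ℕ} (z : ceSpace 1 m n) :
    muLin m n ⟨proj _ n z.1, proj_mem z.2⟩ =
      ⟨degZero _ n (ceD (adAct _ n) z.1), degZero_mem (ceD_mem z.2)⟩ :=
  Subtype.ext (congrArg (degZero _ n) (ceD_proj z.2))

/-- The morphism of bimodules `μ^{(1)} : δ^{(1)}CatLie → CatLie`. -/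
def muBimod : deltaBimod ⟶ catLieBimod :=
  ObjectProperty.homMk
    { app := fun m => ObjectProperty.homMk
        { app := fun n => ModuleCat.ofHom (muLin m.unop.arity n.arity)
          naturality := fun n p χ => by
            ext z
            refine Subtype.ext ?_
            exact ((congrArg (degZero _ _) (ceD_rTensor χ z.1)).trans
              (degZero_rTensor χ _)) }
      naturality := fun m k φ => by
        apply ObjectProperty.hom_ext
        ext n z
        refine (muLin_proj ⟨ceAct _ (deltaIncl z) φ.unop.1, ceAct_mem _ φ.unop.2⟩).trans
          (Subtype.ext ?_)
        exact (congrArg (degZero _ _) (ceD_ceAct (deltaIncl z) _).symm).trans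
          (degZero_ceAct _ _) }

/-- The terms of `ℂLie`: `CatLie` in degree zero, `δ^{(1)}CatLie` in degree one, and zero in
higher degrees. -/
def dgX : ℕ → Bimod
  | 0 => catLieBimod
  | 1 => deltaBimod
  | _ + 2 => ⟨(Functor.const _).obj ⟨(Functor.const _).obj (ModuleCat.of ℚ PUnit), ⟨fun {_ _ _ _} =>
      by ext; rfl⟩⟩, ⟨fun {_ _ _ _} => by apply ObjectProperty.hom_ext; ext; rfl⟩⟩

/-- The differential of `ℂLie`, given by `μ^{(1)}`. -/
def dgDiff : ∀ t, dgX (t + 1) ⟶ dgX t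
  | 0 => muBimod
  | _ + 1 => 0

/-- The complex of `CatLie`-bimodules `ℂLie = (δ^{(1)}CatLie → CatLie)`. -/
def dgComplex : ChainComplex Bimod ℕ :=
  ChainComplex.of dgX dgDiff fun t => by
    simp [dgDiff]

/-- The components of the morphism `CE_Lie → ℂLie`. -/
def ceToDgF : ∀ t, ceBimod t ⟶ dgX t
  | 0 => ceZero
  | 1 => projBimod
  | _ + 2 => 0

/-- The morphism of complexes of `CatLie`-bimodules `CE_Lie → ℂLie` that is the identity of
`CatLie` in degree zero and `π` in degree one. -/
def ceToDg : ceComplex ⟶ dgComplex :=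
  ChainComplex.ofHom (X := ceComplex) (Y := dgComplex) ceToDgF fun t => by
    have h1 : ceComplex.d (t + 1) t = ceDiff t := ChainComplex.of_d _ _ _
    have h2 : dgComplex.d (t + 1) t = dgDiff t := ChainComplex.of_d _ _ _
    rw [h1, h2]
    match t with
    | 0 =>
      apply ObjectProperty.hom_ext
      ext m : 2
      apply ObjectProperty.hom_ext
      ext n z
      exact muLin_proj z
    | 1 =>
      apply ObjectProperty.hom_ext
      ext m : 2
      apply ObjectProperty.hom_ext
      ext n z
      refine Subtype.ext ?_
      exact (proj_ceD z.2).symm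
    | t + 2 => exact Limits.zero_comp.trans Limits.comp_zero.symm

end Bimodules

/-! ### The tensor product over `CatLie` -/

section Tensor

open Opposite

instance : DecidableEq CatLie := fun m n =>
  decidable_of_iff (m.arity = n.arity) ⟨fun h => by cases m; cases n; cases h; rfl, congrArg _⟩

/-- The relations `b · φ ⊗ x ∼ b ⊗ φ · x` that define the tensor product over `CatLie`. -/
def tensorRel (R : CatLieᵒᵖ ⥤ ModuleCat.{0} ℚ) (M : CatLie ⥤ ModuleCat.{u} ℚ) :
    Submodule ℚ (DirectSum CatLie fun m => R.obj (op m) ⊗[ℚ] M.obj m) :=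
  Submodule.span ℚ {z | ∃ (k m : CatLie) (φ : k ⟶ m) (b : R.obj (op m)) (x : M.obj k),
    DirectSum.lof ℚ CatLie (fun m => R.obj (op m) ⊗[ℚ] M.obj m) k (R.map φ.op b ⊗ₜ x) -
      DirectSum.lof ℚ CatLie (fun m => R.obj (op m) ⊗[ℚ] M.obj m) m (b ⊗ₜ M.map φ x) = z}

/-- The tensor product `R ⊗_CatLie M` of a right and a left `CatLie`-module. -/
abbrev TensorSpace (R : CatLieᵒᵖ ⥤ ModuleCat.{0} ℚ) (M : CatLie ⥤ ModuleCat.{u} ℚ) : Type u :=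
  (DirectSum CatLie fun m => R.obj (op m) ⊗[ℚ] M.obj m) ⧸ tensorRel R M

variable {R R' R'' : CatLieᵒᵖ ⥤ ModuleCat.{0} ℚ} {M M' M'' : CatLie ⥤ ModuleCat.{u} ℚ}

/-- The class of `b ⊗ x` in `R ⊗_CatLie M`. -/
def tensorMk {m : CatLie} (b : R.obj (op m)) (x : M.obj m) : TensorSpace R M :=
  (tensorRel R M).mkQ (DirectSum.lof ℚ CatLie (fun m => R.obj (op m) ⊗[ℚ] M.obj m) m (b ⊗ₜ x))

/-- The maps `f ⊗ g` on the direct sum of the tensor products over `ℚ`. -/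
def tensorSumMap (f : R ⟶ R') (g : M ⟶ M') :
    (DirectSum CatLie fun m => R.obj (op m) ⊗[ℚ] M.obj m) →ₗ[ℚ]
      DirectSum CatLie fun m => R'.obj (op m) ⊗[ℚ] M'.obj m :=
  DirectSum.toModule ℚ CatLie _ fun m =>
    DirectSum.lof ℚ CatLie (fun m => R'.obj (op m) ⊗[ℚ] M'.obj m) m ∘ₗ
      TensorProduct.map (f.app (op m)).hom (g.app m).hom

theorem tensorSumMap_lof (f : R ⟶ R') (g : M ⟶ M') (m : CatLie) (b : R.obj (op m)) (x : M.obj m) :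
    tensorSumMap f g (DirectSum.lof ℚ CatLie (fun m => R.obj (op m) ⊗[ℚ] M.obj m) m (b ⊗ₜ x)) =
      DirectSum.lof ℚ CatLie (fun m => R'.obj (op m) ⊗[ℚ] M'.obj m) m
        (f.app (op m) b ⊗ₜ g.app m x) := by
  simp [tensorSumMap]

/-- The map `f ⊗ g : R ⊗_CatLie M → R' ⊗_CatLie M'`. -/
def tensorMap (f : R ⟶ R') (g : M ⟶ M') : TensorSpace R M →ₗ[ℚ] TensorSpace R' M' :=
  (tensorRel R M).mapQ (tensorRel R' M') (tensorSumMap f g) <| by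
    rw [tensorRel, Submodule.span_le]
    rintro z ⟨k, m, φ, b, x, rfl⟩
    refine Submodule.subset_span ⟨k, m, φ, f.app (op m) b, g.app k x, ?_⟩
    rw [map_sub, tensorSumMap_lof, tensorSumMap_lof]
    have h1 : f.app (op k) (R.map φ.op b) = R'.map φ.op (f.app (op m) b) :=
      ConcreteCategory.congr_hom (f.naturality φ.op) b
    have h2 : g.app m (M.map φ x) = M'.map φ (g.app k x) :=
      ConcreteCategory.congr_hom (g.naturality φ) x
    rw [h1, h2]

@[simp] theorem tensorMap_tensorMk (f : R ⟶ R') (g : M ⟶ M') {m : CatLie} (b : R.obj (op m))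
    (x : M.obj m) : tensorMap f g (tensorMk b x) = tensorMk (f.app (op m) b) (g.app m x) :=
  congrArg (tensorRel R' M').mkQ (tensorSumMap_lof f g m b x)

theorem tensor_ext {N : Type*} [AddCommGroup N] [Module ℚ N] {f g : TensorSpace R M →ₗ[ℚ] N}
    (h : ∀ (m : CatLie) (b : R.obj (op m)) (x : M.obj m), f (tensorMk b x) = g (tensorMk b x)) :
    f = g := by
  refine Submodule.linearMap_qext _ (DirectSum.linearMap_ext ℚ fun m => ?_)
  exact TensorProduct.ext' fun b x => h m b x

theorem tensorMap_id : tensorMap (𝟙 R) (𝟙 M) = LinearMap.id :=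
  tensor_ext fun m b x => by simp

theorem tensorMap_comp (f : R ⟶ R') (f' : R' ⟶ R'') (g : M ⟶ M') (g' : M' ⟶ M'') :
    tensorMap (f ≫ f') (g ≫ g') = tensorMap f' g' ∘ₗ tensorMap f g :=
  tensor_ext fun m b x => by simp

theorem tensorMk_add_left {m : CatLie} (b c : R.obj (op m)) (x : M.obj m) :
    tensorMk (b + c) x = tensorMk b x + tensorMk c x := by
  simp [tensorMk, add_tmul]

theorem tensorMap_add_left (f f' : R ⟶ R') (g : M ⟶ M') :
    tensorMap (f + f') g = tensorMap f g + tensorMap f' g :=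
  tensor_ext fun m b x => by simp [tensorMk_add_left]

/-- The right `CatLie`-module `m ↦ B(m, n)`. -/
abbrev rightAt (B : Bimod) (n : CatLie) : CatLieᵒᵖ ⥤ ModuleCat.{0} ℚ :=
  B.obj ⋙ AdditiveFunctor.forget _ _ ⋙ (evaluation CatLie (ModuleCat.{0} ℚ)).obj n

/-- The morphism `B(-, n) → B(-, p)` given by the left action of `χ : n ⟶ p`. -/
abbrev rightAtMap (B : Bimod) {n p : CatLie} (χ : n ⟶ p) : rightAt B n ⟶ rightAt B p :=
  Functor.whiskerLeft (B.obj ⋙ AdditiveFunctor.forget _ _)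
    ((evaluation CatLie (ModuleCat.{0} ℚ)).map χ)

/-- The morphism `B(-, n) → B'(-, n)` induced by a morphism of bimodules. -/
abbrev rightAtHom {B B' : Bimod} (f : B ⟶ B') (n : CatLie) : rightAt B n ⟶ rightAt B' n :=
  Functor.whiskerRight f.hom
    (AdditiveFunctor.forget _ _ ⋙ (evaluation CatLie (ModuleCat.{0} ℚ)).obj n)

/-- The left `CatLie`-module `B ⊗_CatLie M`, for `B` a bimodule and `M` a left module. -/
def tensorObj (B : Bimod) (M : LeftMod.{u}) : LeftMod.{u} :=
  ⟨{ obj := fun n => ModuleCat.of ℚ (TensorSpace (rightAt B n) M.obj)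
     map := fun χ => ModuleCat.ofHom (tensorMap (rightAtMap B χ) (𝟙 M.obj))
     map_id := fun n => by
       apply ModuleCat.hom_ext
       refine tensor_ext fun m b x => ?_
       simp
     map_comp := fun χ ψ => by
       apply ModuleCat.hom_ext
       refine tensor_ext fun m b x => ?_
       simp },
   ⟨fun {n p χ ψ} => by
      apply ModuleCat.hom_ext
      refine (congrArg (tensorMap · (𝟙 M.obj)) ?_).trans
        (tensorMap_add_left (rightAtMap B χ) (rightAtMap B ψ) (𝟙 M.obj))
      ext m b
      simp⟩⟩

/-- The morphism `f ⊗ g : B ⊗_CatLie M → B' ⊗_CatLie M'` of left `CatLie`-modules. -/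
def tensorHom {B B' : Bimod} {M M' : LeftMod.{u}} (f : B ⟶ B') (g : M ⟶ M') :
    tensorObj B M ⟶ tensorObj B' M' :=
  ObjectProperty.homMk
    { app := fun n => ModuleCat.ofHom (tensorMap (rightAtHom f n) g.hom)
      naturality := fun n p χ => by
        apply ModuleCat.hom_ext
        refine (tensorMap_comp (rightAtMap B χ) (rightAtHom f p) (𝟙 M.obj) g.hom).symm.trans
          (Eq.trans ?_ (tensorMap_comp (rightAtHom f n) (rightAtMap B' χ) g.hom (𝟙 M'.obj)))
        refine congrArg₂ tensorMap ?_ (by rw [Category.id_comp, Category.comp_id])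
        ext m b
        exact ConcreteCategory.congr_hom ((f.hom.app m).hom.naturality χ) b }

theorem tensorHom_id (B : Bimod) (M : LeftMod.{u}) : tensorHom (𝟙 B) (𝟙 M) = 𝟙 (tensorObj B M) := by
  apply ObjectProperty.hom_ext
  ext n : 2
  apply ModuleCat.hom_ext
  exact tensorMap_id

theorem tensorHom_comp {B B' B'' : Bimod} {M M' M'' : LeftMod.{u}} (f : B ⟶ B') (f' : B' ⟶ B'')
    (g : M ⟶ M') (g' : M' ⟶ M'') :
    tensorHom (f ≫ f') (g ≫ g') = tensorHom f g ≫ tensorHom f' g' := by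
  apply ObjectProperty.hom_ext
  ext n : 2
  apply ModuleCat.hom_ext
  exact tensorMap_comp (rightAtHom f n) (rightAtHom f' n) g.hom g'.hom

theorem tensorHom_add_left {B B' : Bimod} {M M' : LeftMod.{u}} (f f' : B ⟶ B') (g : M ⟶ M') :
    tensorHom (f + f') g = tensorHom f g + tensorHom f' g := by
  apply ObjectProperty.hom_ext
  ext n : 2
  apply ModuleCat.hom_ext
  exact tensorMap_add_left (rightAtHom f n) (rightAtHom f' n) g.hom

/-- The functor `B ↦ B ⊗_CatLie M` from bimodules to left modules. -/
def tensorWith (M : LeftMod.{u}) : Bimod ⥤ LeftMod.{u} where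
  obj B := tensorObj B M
  map f := tensorHom f (𝟙 M)
  map_id B := tensorHom_id B M
  map_comp f f' := by rw [← tensorHom_comp, Category.id_comp]

instance (M : LeftMod.{u}) : (tensorWith M).Additive where
  map_add := tensorHom_add_left _ _ _

/-- The natural transformation `- ⊗_CatLie M → - ⊗_CatLie M'` induced by `g : M → M'`. -/
def tensorWithMap {M M' : LeftMod.{u}} (g : M ⟶ M') : tensorWith M ⟶ tensorWith M' where
  app B := tensorHom (𝟙 B) g
  naturality B B' f := by
    refine (tensorHom_comp f (𝟙 B') (𝟙 M) g).symm.trans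
      (Eq.trans ?_ (tensorHom_comp (𝟙 B) f g (𝟙 M')))
    simp only [Category.id_comp, Category.comp_id]

/-- For a complex of bimodules `K`, the functor `M ↦ K ⊗_CatLie M` from left modules to complexes
of left modules. -/
def complexTensor (K : ChainComplex Bimod ℕ) : LeftMod.{u} ⥤ ChainComplex LeftMod.{u} ℕ where
  obj M := ((tensorWith M).mapHomologicalComplex _).obj K
  map g := (NatTrans.mapHomologicalComplex (tensorWithMap g) _).app K
  map_id M := by
    ext t : 1
    exact tensorHom_id (K.X t) M
  map_comp g g' := by
    ext t : 1
    refine Eq.trans ?_ (tensorHom_comp (𝟙 (K.X t)) (𝟙 (K.X t)) g g')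
    rw [Category.id_comp]
    rfl

/-- The natural transformation `K ⊗_CatLie - → K' ⊗_CatLie -` induced by a morphism `K → K'` of
complexes of bimodules. -/
def complexTensorMap {K K' : ChainComplex Bimod ℕ} (f : K ⟶ K') :
    complexTensor.{u} K ⟶ complexTensor K' where
  app M := ((tensorWith M).mapHomologicalComplex _).map f
  naturality _ _ g := (NatTrans.mapHomologicalComplex_naturality (tensorWithMap g) f).symm

/-- The homology in degree `i` of a complex of left `CatLie`-modules, computed in the abelian
category of all functors from `CatLie` to `ℚ`-vector spaces. -/
def leftHomology (i : ℕ) : ChainComplex LeftMod.{u} ℕ ⥤ (CatLie ⥤ ModuleCat.{u} ℚ) :=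
  (AdditiveFunctor.forget _ _).mapHomologicalComplex _ ⋙ HomologicalComplex.homologyFunctor _ _ i

end Tensor

/-- The natural transformation `H_i(CE_Lie ⊗_CatLie M) → H_i(ℂLie ⊗_CatLie M)` induced by the
morphism of complexes of bimodules `CE_Lie → ℂLie`. -/
def ceToDgHomology (i : ℕ) :
    complexTensor.{u} ceComplex ⋙ leftHomology i ⟶ complexTensor dgComplex ⋙ leftHomology i :=
  Functor.whiskerRight (complexTensorMap ceToDg) (leftHomology i)

end LieProp

end

/-! Everything rests on three facts about the morphism of bimodules, checked on the vector spaces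
`B(m, n)` before any tensor product is formed. In degree zero it is an isomorphism, because an
element of exterior degree zero is uniquely of the form `y ⊗ 1` (`ceZero_bijective`). In degree one
`π` fixes the subspace onto which it projects, so it is onto (`projBimod_surjective`). In degrees at
least two the target vanishes.

Both properties survive `- ⊗_CatLie M` with no condition on `M`. The tensor product is generated by
the classes of `b ⊗ x`, so it suffices to lift `b` (`tensorMap_surjective`); and being a functor it
sends isomorphisms to isomorphisms. This gives the surjectivity in every degree. Naturality in `M`
is already part of the construction of `complexTensorMap` and `ceToDgHomology` as natural
transformations.

A degreewise epimorphism of complexes need not be an epimorphism on homology, since a cycle may lift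
only to a chain. Here the isomorphism in degree zero removes the obstruction. A 1-cycle of the
target lifts to a 1-chain `x`; the boundary of `x` has zero image under an isomorphism, hence is
zero, and `x` is a cycle. This is `epi_homologyMap_of_epi_of_mono`. In degree zero the chains are
identified, and the boundaries correspond because the map in degree one is onto, so `H_0` is
preserved. In degrees at least two there is nothing to hit. No exactness of either complex of
bimodules is involved.

Homology is taken in the abelian category of all functors `CatLie ⥤ ModuleCat ℚ`. There epimorphisms
are evaluated objectwise, and this converts between the categorical statements and the surjectivity
of linear maps. -/

namespace CategoryTheory.ShortComplex

/-! ### Lifting cycles along a morphism of short complexes. -/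

variable {C : Type*} [Category* C] [Abelian C] {S T : ShortComplex C}

/-- A morphism of short complexes that is an epimorphism in the middle and a monomorphism on the
right induces an epimorphism on homology. -/
theorem epi_homologyMap_of_epi_of_mono (φ : S ⟶ T) [Epi φ.τ₂] [Mono φ.τ₃] :
    Epi (homologyMap φ) := by
  have : Epi (cyclesMap φ) := by
    rw [epi_iff_surjective_up_to_refinements]
    intro A y
    -- A generalized element of the cycles of `T` is lifted to the middle term of `S` after a
    -- refinement `p`; so far the lift `x` is only a chain.
    obtain ⟨A', p, hp, x, hx⟩ := surjective_up_to_refinements_of_epi φ.τ₂ (y ≫ T.iCycles)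
    -- The lift is a cycle: followed by `φ.τ₃`, its boundary is the boundary of the given cycle of
    -- `T`, which vanishes, and `φ.τ₃` is a monomorphism.
    have hx0 : x ≫ S.g = 0 := by
      rw [← cancel_mono φ.τ₃, Category.assoc, ← φ.comm₂₃, ← reassoc_of% hx]
      simp
    refine ⟨A', p, hp, S.liftCycles x hx0, ?_⟩
    rw [← cancel_mono T.iCycles]
    simp [hx]
  -- Homology is a quotient of cycles, so by naturality this composite is `cyclesMap φ` followed by
  -- the epimorphism `T.homologyπ`.
  have h : Epi (S.homologyπ ≫ homologyMap φ) := by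
    rw [homologyπ_naturality]
    infer_instance
  exact epi_of_epi S.homologyπ _

end CategoryTheory.ShortComplex

noncomputable section

namespace LieProp

/-! ### Surjectivity of tensor products over `CatLie`. -/

open Opposite

/-- The range is a subspace, so it is enough to reach the classes `tensorMk b x`, which span the
target. Only `b` has to be lifted, separately for each object, so the lifts need not respect the
action of `CatLie`. -/
theorem tensorMap_surjective {R R' : CatLieᵒᵖ ⥤ ModuleCat.{0} ℚ} (M : CatLie ⥤ ModuleCat.{u} ℚ)
    (f : R ⟶ R') (hf : ∀ m, Function.Surjective (f.app m)) :
    Function.Surjective (tensorMap f (𝟙 M)) := by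
  rw [← LinearMap.range_eq_top, eq_top_iff]
  rintro z -
  obtain ⟨z, rfl⟩ := (tensorRel R' M).mkQ_surjective z
  induction z using DirectSum.induction_on with
  | zero => simp
  | add a b ha hb => rw [map_add]; exact add_mem ha hb
  | of m z =>
    induction z with
    | zero => simp
    | add a b ha hb => simp only [map_add]; exact add_mem ha hb
    | tmul b x =>
      obtain ⟨c, rfl⟩ := hf (op m) b
      exact ⟨tensorMk c x, tensorMap_tensorMk f (𝟙 M) c x⟩

/-! ### The components of the morphism of bimodules. -/

/-- This makes `y ↦ y ⊗ 1` a map from `CatLie(m, n)` to `CE_0(m, n)`, the candidate inverse of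
`degZero`. On a generator, the empty family of exterior factors contributes no letters and its
product is `1`. -/
theorem tmul_one_mem_ceSpan {α : Type} {n : ℕ} {A : Multiset α} {y} (hy : y ∈ tensSpan n A) :
    y ⊗ₜ[ℚ] (1 : ExteriorAlgebra ℚ (FreeLieAlgebra ℚ α)) ∈ ceSpan n 0 A := by
  induction hy using Submodule.span_induction with
  | zero => simp
  | add y z _ _ hy hz => rw [add_tmul]; exact add_mem hy hz
  | smul c z _ hz => rw [← smul_tmul']; exact Submodule.smul_mem _ c hz
  | mem z hz =>
    obtain ⟨T, hA, rfl⟩ := hz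
    exact Submodule.subset_span ⟨T, Fin.elim0, by simpa using hA, by simp⟩

theorem degZero_tmul_one {g : Type*} [LieRing g] [LieAlgebra ℚ g] {n : ℕ} (y : Tens n g) :
    degZero g n (y ⊗ₜ 1) = y := by simp [degZero]

/-- The second half of the inverse relation. It needs `z` to have exterior degree zero: on the whole
of `M ⊗ Λ`, `degZero` discards the terms of positive degree. -/
theorem degZero_tmul_one_of_mem {α : Type} {n : ℕ} {A : Multiset α} {z}
    (hz : z ∈ ceSpan n 0 A) : degZero (FreeLieAlgebra ℚ α) n z ⊗ₜ 1 = z :=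
  ceSpan_zero_induction (P := fun z => degZero (FreeLieAlgebra ℚ α) n z ⊗ₜ 1 = z)
    (fun y _ => by rw [degZero_tmul_one]) hz

/-- The inverse is `y ↦ y ⊗ 1`. Besides giving surjectivity in degree zero, the injectivity proved
here is what later forces lifts of 1-cycles to be cycles. -/
theorem ceZero_bijective (m : CatLieᵒᵖ) (n : CatLie) :
    Function.Bijective ((ceZero.hom.app m).hom.app n) := by
  constructor
  · intro y z h
    refine Subtype.ext ?_
    rw [← degZero_tmul_one_of_mem y.2, ← degZero_tmul_one_of_mem z.2]
    exact congrArg (· ⊗ₜ 1) (congrArg Subtype.val h)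
  · intro y
    exact ⟨⟨_, tmul_one_mem_ceSpan y.2⟩, Subtype.ext (degZero_tmul_one _)⟩

/-- The inclusion of `δ^{(1)}CatLie(m, n)` in `CE_1(m, n)` is a section of `π`, because `π` fixes
each `z ⊗ x_a`. A linear section for each pair `(m, n)` is enough. -/
theorem projBimod_surjective (m : CatLieᵒᵖ) (n : CatLie) :
    Function.Surjective ((projBimod.hom.app m).hom.app n) := fun z =>
  ⟨deltaIncl z, Subtype.ext (proj_deltaSpan z.2)⟩

theorem ceToDgF_surjective : ∀ (t : ℕ) (m : CatLieᵒᵖ) (n : CatLie),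
    Function.Surjective (((ceToDgF t).hom.app m).hom.app n)
  | 0, m, n => (ceZero_bijective m n).2
  | 1, m, n => projBimod_surjective m n
  -- From degree two on, the values of `dgX` are `PUnit`, so any element is a preimage.
  | _ + 2, _, _ => fun _ => ⟨0, Subsingleton.elim (α := PUnit) _ _⟩

/-- A morphism of bimodules all of whose components are bijective is an isomorphism. -/
theorem isIso_of_bijective {B B' : Bimod} (f : B ⟶ B')
    (hf : ∀ m n, Function.Bijective ((f.hom.app m).hom.app n)) : IsIso f := by
  -- A bimodule is a functor with values in functors, each time in a full subcategory of additive
  -- ones. The argument therefore runs twice, for fixed `m` and then for varying `m`: an objectwise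
  -- isomorphism is an isomorphism of functors, and the forgetful functor reflects it.
  have h (m : CatLieᵒᵖ) : IsIso (f.hom.app m) := by
    have (n : CatLie) : IsIso ((f.hom.app m).hom.app n) :=
      (ConcreteCategory.isIso_iff_bijective _).2 (hf m n)
    have : IsIso ((AdditiveFunctor.forget _ _).map (f.hom.app m)) :=
      NatIso.isIso_of_isIso_app (f.hom.app m).hom
    exact isIso_of_reflects_iso _ (AdditiveFunctor.forget CatLie (ModuleCat.{0} ℚ))
  have : IsIso ((AdditiveFunctor.forget _ _).map f) := NatIso.isIso_of_isIso_app f.hom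
  exact isIso_of_reflects_iso _ (AdditiveFunctor.forget CatLieᵒᵖ LeftMod.{0})

/-! ### The morphism of complexes after tensoring with a left module. -/

theorem ceToDg_tensor_surjective (M : LeftMod.{u}) (t : ℕ) (n : CatLie) :
    Function.Surjective ((((complexTensorMap.{u} ceToDg).app M).f t).hom.app n) :=
  tensorMap_surjective M.obj (rightAtHom (ceToDgF t) n) fun m => ceToDgF_surjective t m n

/-- The morphism of complexes whose homology maps are the components of `ceToDgHomology`. -/
abbrev ceToDgFunctorMap (M : LeftMod.{u}) :=
  ((AdditiveFunctor.forget CatLie (ModuleCat.{u} ℚ)).mapHomologicalComplex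
    (ComplexShape.down ℕ)).map ((complexTensorMap.{u} ceToDg).app M)

/-- Objectwise surjectivity, restated in the functor category where homology is computed. -/
instance (M : LeftMod.{u}) (t : ℕ) : Epi ((ceToDgFunctorMap M).f t) := by
  have (n : CatLie) : Epi (((ceToDgFunctorMap M).f t).app n) :=
    (ModuleCat.epi_iff_surjective _).2 (ceToDg_tensor_surjective M t n)
  exact NatTrans.epi_of_epi_app _

/-- Tensoring and then forgetting additivity is a functor, so the isomorphism of bimodules in degree
zero is preserved, whatever `M` is. -/
instance (M : LeftMod.{u}) : IsIso ((ceToDgFunctorMap M).f 0) := by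
  have : IsIso (ceToDgF 0) := isIso_of_bijective ceZero ceZero_bijective
  exact inferInstanceAs
    (IsIso ((AdditiveFunctor.forget _ _).map ((tensorWith M).map (ceToDgF 0))))

/-! ### The induced map on homology. -/

/-- `H_0` is the cokernel of the differential from degree one. It is unchanged when the map is an
isomorphism in degree zero and an epimorphism in degree one. -/
theorem isIso_ceToDgHomology_zero (M : LeftMod.{u}) : IsIso ((ceToDgHomology.{u} 0).app M) := by
  change IsIso (HomologicalComplex.homologyMap (ceToDgFunctorMap M) 0)
  -- The indices are `1 → 0 → 0`: nothing follows degree zero, so `next 0` takes its default value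
  -- `0`, with zero differential. Hence the third component is again the isomorphism of degree zero.
  rw [← quasiIsoAt_iff_isIso_homologyMap, quasiIsoAt_iff' _ 1 0 0 (by simp) (by simp)]
  have : Epi ((HomologicalComplex.shortComplexFunctor' _ _ 1 0 0).map (ceToDgFunctorMap M)).τ₁ :=
    inferInstanceAs (Epi ((ceToDgFunctorMap M).f 1))
  have : IsIso ((HomologicalComplex.shortComplexFunctor' _ _ 1 0 0).map (ceToDgFunctorMap M)).τ₂ :=
    inferInstanceAs (IsIso ((ceToDgFunctorMap M).f 0))
  have : Mono ((HomologicalComplex.shortComplexFunctor' _ _ 1 0 0).map (ceToDgFunctorMap M)).τ₃ :=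
    inferInstanceAs (Mono ((ceToDgFunctorMap M).f 0))
  exact ShortComplex.quasiIso_of_epi_of_isIso_of_mono _

/-- The lifting of cycles applies around degree one: the middle component is an epimorphism and the
right-hand one, in degree zero, is an isomorphism. -/
theorem epi_ceToDgHomology_one (M : LeftMod.{u}) : Epi ((ceToDgHomology.{u} 1).app M) := by
  have h : (ComplexShape.down ℕ).next 1 = 0 := by simp
  have : Mono ((ceToDgFunctorMap M).f ((ComplexShape.down ℕ).next 1)) := by
    rw [h]
    infer_instance
  have : Epi ((HomologicalComplex.shortComplexFunctor _ _ 1).map (ceToDgFunctorMap M)).τ₂ :=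
    inferInstanceAs (Epi ((ceToDgFunctorMap M).f 1))
  have : Mono ((HomologicalComplex.shortComplexFunctor _ _ 1).map (ceToDgFunctorMap M)).τ₃ :=
    inferInstanceAs (Mono ((ceToDgFunctorMap M).f ((ComplexShape.down ℕ).next 1)))
  exact ShortComplex.epi_homologyMap_of_epi_of_mono
    ((HomologicalComplex.shortComplexFunctor _ _ 1).map (ceToDgFunctorMap M))

/-- The lifting argument is not used here; instead the target has zero chains, hence zero homology,
and every morphism to a zero object is an epimorphism. -/
theorem epi_ceToDgHomology_add_two (M : LeftMod.{u}) (i : ℕ) :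
    Epi ((ceToDgHomology.{u} (i + 2)).app M) := by
  have hX (n : CatLie) : Subsingleton (TensorSpace (rightAt (dgX (i + 2)) n) M.obj) := by
    refine subsingleton_of_forall_eq 0 fun z => ?_
    -- The identity and the zero map agree on every class of `b ⊗ x`, because `b` lies in a zero
    -- space; hence they are equal.
    exact LinearMap.congr_fun (tensor_ext (f := LinearMap.id) (g := 0) fun m b x => by
      rw [show b = 0 from Subsingleton.elim (α := PUnit) _ _]
      simp [tensorMk]) z
  have h : Limits.IsZero ((((AdditiveFunctor.forget CatLie (ModuleCat.{u} ℚ)).mapHomologicalComplex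
      (ComplexShape.down ℕ)).obj ((complexTensor.{u} dgComplex).obj M)).X (i + 2)) := by
    refine Functor.isZero _ fun n => ?_
    exact @ModuleCat.isZero_of_subsingleton _ _ _ (hX n)
  exact (ShortComplex.isZero_homology_of_isZero_X₂ _ h).epi _

theorem epi_ceToDgHomology (M : LeftMod.{u}) : ∀ i, Epi ((ceToDgHomology.{u} i).app M)
  | 0 => have := isIso_ceToDgHomology_zero M; IsIso.epi_of_iso _
  | 1 => epi_ceToDgHomology_one M
  | i + 2 => epi_ceToDgHomology_add_two M i

/-- Evaluation at an object preserves epimorphisms of functors, and an epimorphism of vector spaces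
is surjective. -/
theorem ceToDgHomology_surjective (M : LeftMod.{u}) (i : ℕ) (n : CatLie) :
    Function.Surjective (((ceToDgHomology.{u} i).app M).app n) := by
  have := epi_ceToDgHomology M i
  have h : Epi (((evaluation CatLie (ModuleCat.{u} ℚ)).obj n).map
    ((ceToDgHomology.{u} i).app M)) := Functor.map_epi _ _
  exact (ModuleCat.epi_iff_surjective _).1 h

end LieProp

end

/-- The natural transformation `CE_Lie ⊗_CatLie M → ℂLie ⊗_CatLie M` of complexes of left
`CatLie`-modules is surjective in every degree. The natural transformation that it induces on
homology is surjective (in degree one and, trivially, in higher degrees as well), and it is an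
isomorphism in degree zero. -/
theorem mainTheorem9 :
    (∀ (M : LieProp.LeftMod.{u}) (t : ℕ) (n : LieProp.CatLie), Function.Surjective
      ((((LieProp.complexTensorMap.{u} LieProp.ceToDg).app M).f t).hom.app n)) ∧
    (∀ M : LieProp.LeftMod.{u}, IsIso ((LieProp.ceToDgHomology.{u} 0).app M)) ∧
    (∀ (M : LieProp.LeftMod.{u}) (i : ℕ) (n : LieProp.CatLie), Function.Surjective
      (((LieProp.ceToDgHomology.{u} i).app M).app n)) := by
  exact ⟨LieProp.ceToDg_tensor_surjective, LieProp.isIso_ceToDgHomology_zero,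
    LieProp.ceToDgHomology_surjective⟩
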